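/- Conventions. Manifolds, maps and sections are smooth, $\Gamma(D)$ denotes the smooth sections over $U$ of a family of subspaces $D$ of the tangent spaces, indices $\alpha$ are taken in $\{1,2,3\}$ modulo $3$, and $\nabla$ is the Levi-Civita connection of $g_M$. Let $(M,E,g_M)$ be a quaternionic Kähler manifold: $E\subset \mathrm{End}(TM)$ is a rank-$3$ subbundle which locally has a quaternionic Hermitian basis $\{J_1,J_2,J_3\}$, i.e. $J_\alpha^2=-\mathrm{id}$, $J_\alpha J_{\alpha+1}=-J_{\alpha+1}J_\alpha=J_{\alpha+2}$, $g_M(J_\alpha X,J_\alpha Y)=g_M(X,Y)$, together with local $1$-forms $\omega_1,\omega_2,\omega_3$ satisfying $$\nabla_XJ_\alpha=\omega_{\alpha+2}(X)J_{\alpha+1}-\omega_{\alpha+1}(X)J_{\alpha+2}.$$ Let $(N,g_N)$ be a Riemannian manifold with $\dim N<\dim M$, and let $F:M\to N$ be an almost $h$-conformal semi-invariant submersion with dilation $\lambda:M\to(0,\infty)$. This means that $F$ is a surjective submersion, that $g_N(F_*X,F_*Y)=\lambda^2g_M(X,Y)$ for $X,Y\in(\ker F_*)^\perp$, and that each point of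 $M$ has a neighbourhood carrying an almost $h$-conformal semi-invariant basis. Here a quaternionic Hermitian basis $\{J_1,J_2,J_3\}$ of $E$ over an open set $U$ is called almost $h$-conformal semi-invariant if for each $\alpha$ there is a distribution $\mathcal D_1^{J_\alpha}\subset\ker F_*$ on $U$ such that $J_\alpha(\mathcal D_1^{J_\alpha})=\mathcal D_1^{J_\alpha}$ and $J_\alpha(\mathcal D_2^{J_\alpha})\subset(\ker F_*)^\perp$, where $\mathcal D_2^{J_\alpha}$ is the orthogonal complement of $\mathcal D_1^{J_\alpha}$ in $\ker F_*$. Fix such a basis $\{J_1,J_2,J_3\}$ over an open set $U\subset M$ ($U=M$ if the basis is global), with $1$-forms $\omega_\alpha$ as above on $U$. Let $\mathcal V,\mathcal H$ be the orthogonal projections onto $\ker F_*$ and $(\ker F_*)^\perp$. For horizontal $X$ write $J_\alpha X=B_{J_\alpha}X+C_{J_\alpha}X$ with $B_{J_\alpha}X=\mathcal V J_\alpha X$, $C_{J_\alpha}X=\mathcal H J_\alpha X$. Let $\mu^{J_\alpha}$ be the orthogonal complement of $J_\alpha\mathcal D_2^{J_\alpha}$ in $(\ker F_*)^\perp$, let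 $\mathcal A_XY=\mathcal H\nabla_{\mathcal HX}\mathcal VY+\mathcal V\nabla_{\mathcal HX}\mathcal HY$, and let $\nabla^N$ be the connection on $F^{-1}TN$ induced by the Levi-Civita connection of $g_N$. Call $F$ $h$-homothetic on $U$ if $\mathcal H(\operatorname{grad}\lambda)=0$ on $U$. For $\alpha\in\{1,2,3\}$ consider the condition $(\mathrm I_\alpha)$: for all $X,Y\in\Gamma((\ker F_*)^\perp)$ and $V\in\Gamma(\mathcal D_2^{J_\alpha})$, $$\begin{aligned}\lambda^{-2}g_N\big(\nabla^N_YF_*C_{J_\alpha}X-\nabla^N_XF_*C_{J_\alpha}Y,\;F_*J_\alpha V\big)={}&g_M\big(\mathcal A_XB_{J_\alpha}Y-\mathcal A_YB_{J_\alpha}X,\;J_\alpha V\big)\\&+\omega_{\alpha+2}(Y)\,g_M(C_{J_{\alpha+1}}X,J_\alpha V)-\omega_{\alpha+1}(Y)\,g_M(C_{J_{\alpha+2}}X,J_\alpha V)\\&-\omega_{\alpha+2}(X)\,g_M(C_{J_{\alpha+1}}Y,J_\alpha V)+\omega_{\alpha+1}(X)\,g_M(C_{J_{\alpha+2}}Y,J_\alpha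 V).\end{aligned}$$ **Theorem.** Assume that the distribution $(\ker F_*)^\perp$ is integrable on $U$, that is, closed under Lie brackets. Then: 1. If $F$ is $h$-homothetic on $U$, then $(\mathrm I_1)$, $(\mathrm I_2)$ and $(\mathrm I_3)$ hold. 2. For each $\alpha$ such that $\mathcal D_2^{J_\alpha}\neq0$ and $\mu^{J_\alpha}\neq0$ at every point of $U$, $F$ is $h$-homothetic on $U$ if and only if $(\mathrm I_\alpha)$ holds. In particular, if $\mathcal D_2^{J_\alpha}\ne0$ and $\mu^{J_\alpha}\neq0$ at every point of $U$ for all $\alpha\in\{1,2,3\}$, then the four conditions "$F$ is $h$-homothetic on $U$", $(\mathrm I_1)$, $(\mathrm I_2)$, $(\mathrm I_3)$ are equivalent. -/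

import Mathlib

open Bundle FiberBundle VectorField
open scoped Manifold ContDiff Topology InnerProductSpace

noncomputable section

set_option linter.unusedSectionVars false

section LeviCivita

variable {E : Type*} [NormedAddCommGroup E] [NormedSpace ℝ E] [FiniteDimensional ℝ E]
  {M : Type*} [TopologicalSpace M] [ChartedSpace E M] [IsManifold 𝓘(ℝ, E) ∞ M]
  [RiemannianBundle (fun x : M ↦ TangentSpace 𝓘(ℝ, E) x)]
  [IsContMDiffRiemannianBundle 𝓘(ℝ, E) ∞ E (fun x : M ↦ TangentSpace 𝓘(ℝ, E) x)]

instance tangentSpace_finiteDimensional (x : M) : FiniteDimensional ℝ (TangentSpace 𝓘(ℝ, E) x) :=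
  inferInstanceAs (FiniteDimensional ℝ E)

theorem mdiffAt_inner {X Y : Π x : M, TangentSpace 𝓘(ℝ, E) x} {x : M}
    (hX : MDiffAt (T% X) x) (hY : MDiffAt (T% Y) x) : MDiffAt (fun y ↦ ⟪X y, Y y⟫_ℝ) x :=
  MDifferentiableAt.inner_bundle (IB := 𝓘(ℝ, E)) (F := E) (B := M)
    (E := fun x : M ↦ TangentSpace 𝓘(ℝ, E) x) (b := fun y ↦ y) (v := X) (w := Y) hX hY

/-- The right-hand side of the Koszul formula for `2 g(∇_X Y, Z)` at `x`. -/
def koszul (X Y Z : Π x : M, TangentSpace 𝓘(ℝ, E) x) (x : M) : ℝ :=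
  d% (fun y ↦ ⟪Y y, Z y⟫_ℝ) x (X x) + d% (fun y ↦ ⟪X y, Z y⟫_ℝ) x (Y x)
    - d% (fun y ↦ ⟪X y, Y y⟫_ℝ) x (Z x)
    + ⟪mlieBracket 𝓘(ℝ, E) X Y x, Z x⟫_ℝ - ⟪mlieBracket 𝓘(ℝ, E) X Z x, Y x⟫_ℝ
    - ⟪mlieBracket 𝓘(ℝ, E) Y Z x, X x⟫_ℝ

theorem koszul_tensorial₁ {Y : Π x : M, TangentSpace 𝓘(ℝ, E) x} {x : M} (hY : MDiffAt (T% Y) x)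
    (Z : Π x : M, TangentSpace 𝓘(ℝ, E) x) (hZ : MDiffAt (T% Z) x) :
    TensorialAt 𝓘(ℝ, E) E (fun X ↦ koszul X Y Z x) x where
  smul {f X} hf hX := by
    have h1 : (fun y ↦ ⟪(f • X) y, Z y⟫_ℝ) = fun y ↦ f y * ⟪X y, Z y⟫_ℝ := by
      funext y; simp [inner_smul_left]
    have h2 : (fun y ↦ ⟪(f • X) y, Y y⟫_ℝ) = fun y ↦ f y * ⟪X y, Y y⟫_ℝ := by
      funext y; simp [inner_smul_left]
    simp only [koszul, h1, h2, mvfderiv_fun_mul hf (mdiffAt_inner hX hZ),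
      mvfderiv_fun_mul hf (mdiffAt_inner hX hY), mlieBracket_smul_left hf hX]
    simp [inner_add_left, inner_smul_left, inner_smul_right, real_inner_comm]
    ring
  add {X X'} hX hX' := by
    have h1 : (fun y ↦ ⟪(X + X') y, Z y⟫_ℝ) = fun y ↦ ⟪X y, Z y⟫_ℝ + ⟪X' y, Z y⟫_ℝ := by
      funext y; simp [inner_add_left]
    have h2 : (fun y ↦ ⟪(X + X') y, Y y⟫_ℝ) = fun y ↦ ⟪X y, Y y⟫_ℝ + ⟪X' y, Y y⟫_ℝ := by
      funext y; simp [inner_add_left]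
    simp only [koszul, h1, h2, mvfderiv_fun_add (mdiffAt_inner hX hZ) (mdiffAt_inner hX' hZ),
      mvfderiv_fun_add (mdiffAt_inner hX hY) (mdiffAt_inner hX' hY), mlieBracket_add_left hX hX']
    simp [inner_add_left, inner_add_right]
    ring

theorem koszul_tensorial₂ {Y : Π x : M, TangentSpace 𝓘(ℝ, E) x} {x : M} (hY : MDiffAt (T% Y) x)
    (X : Π x : M, TangentSpace 𝓘(ℝ, E) x) (hX : MDiffAt (T% X) x) :
    TensorialAt 𝓘(ℝ, E) E (fun Z ↦ koszul X Y Z x) x where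
  smul {f Z} hf hZ := by
    have h1 : (fun y ↦ ⟪Y y, (f • Z) y⟫_ℝ) = fun y ↦ f y * ⟪Y y, Z y⟫_ℝ := by
      funext y; simp [inner_smul_right]
    have h2 : (fun y ↦ ⟪X y, (f • Z) y⟫_ℝ) = fun y ↦ f y * ⟪X y, Z y⟫_ℝ := by
      funext y; simp [inner_smul_right]
    simp only [koszul, h1, h2, mvfderiv_fun_mul hf (mdiffAt_inner hY hZ),
      mvfderiv_fun_mul hf (mdiffAt_inner hX hZ), mlieBracket_smul_right hf hZ]
    simp [inner_add_left, inner_smul_left, inner_smul_right, real_inner_comm]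
    ring
  add {Z Z'} hZ hZ' := by
    have h1 : (fun y ↦ ⟪Y y, (Z + Z') y⟫_ℝ) = fun y ↦ ⟪Y y, Z y⟫_ℝ + ⟪Y y, Z' y⟫_ℝ := by
      funext y; simp [inner_add_right]
    have h2 : (fun y ↦ ⟪X y, (Z + Z') y⟫_ℝ) = fun y ↦ ⟪X y, Z y⟫_ℝ + ⟪X y, Z' y⟫_ℝ := by
      funext y; simp [inner_add_right]
    simp only [koszul, h1, h2, mvfderiv_fun_add (mdiffAt_inner hY hZ) (mdiffAt_inner hY hZ'),
      mvfderiv_fun_add (mdiffAt_inner hX hZ) (mdiffAt_inner hX hZ'), mlieBracket_add_right hZ hZ']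
    simp [inner_add_left, inner_add_right]
    ring

/-- The Koszul form `(X, Z) ↦ koszul X Y Z x` as a bilinear form on the tangent space at `x`. -/
def koszulForm {Y : Π x : M, TangentSpace 𝓘(ℝ, E) x} {x : M} (hY : MDiffAt (T% Y) x) :
    TangentSpace 𝓘(ℝ, E) x →L[ℝ] TangentSpace 𝓘(ℝ, E) x →L[ℝ] ℝ :=
  TensorialAt.mkHom₂ (fun X Z ↦ koszul X Y Z x) x (koszul_tensorial₁ hY) (koszul_tensorial₂ hY)

open Classical in
/-- The function underlying the Levi-Civita connection: `∇_v Y` at `x` is the tangent vector which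
represents the linear form `½ koszulForm v` (and, conventionally, `0` where `Y` is not
differentiable). -/
def leviCivitaAux (Y : Π x : M, TangentSpace 𝓘(ℝ, E) x) (x : M) :
    TangentSpace 𝓘(ℝ, E) x →L[ℝ] TangentSpace 𝓘(ℝ, E) x :=
  if hY : MDiffAt (T% Y) x then
    haveI : CompleteSpace (TangentSpace 𝓘(ℝ, E) x) := FiniteDimensional.complete ℝ _
    (InnerProductSpace.toDual ℝ (TangentSpace 𝓘(ℝ, E) x)).symm.toContinuousLinearEquiv.toContinuousLinearMap
      ∘L ((1 / 2 : ℝ) • koszulForm hY)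
  else 0

theorem inner_leviCivitaAux {X Y Z : Π x : M, TangentSpace 𝓘(ℝ, E) x} {x : M}
    (hX : MDiffAt (T% X) x) (hY : MDiffAt (T% Y) x) (hZ : MDiffAt (T% Z) x) :
    ⟪leviCivitaAux Y x (X x), Z x⟫_ℝ = (1 / 2) * koszul X Y Z x := by
  have : CompleteSpace (TangentSpace 𝓘(ℝ, E) x) := FiniteDimensional.complete ℝ _
  have h : koszulForm hY (X x) (Z x) = koszul X Y Z x :=
    TensorialAt.mkHom₂_apply (koszul_tensorial₁ hY) (koszul_tensorial₂ hY) hX hZ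
  rw [leviCivitaAux, dif_pos hY, ← h]
  simp [← InnerProductSpace.toDual_symm_apply]
  exact real_inner_smul_left _ _ _

theorem tangent_ext {x : M} {v w : TangentSpace 𝓘(ℝ, E) x}
    (h : ∀ Z : Π x : M, TangentSpace 𝓘(ℝ, E) x, MDiffAt (T% Z) x → ⟪v, Z x⟫_ℝ = ⟪w, Z x⟫_ℝ) :
    v = w := by
  refine ext_inner_right ℝ fun z ↦ ?_
  simpa using h (extend E z) (mdifferentiableAt_extend ..)

theorem koszul_add {X Y Y' Z : Π x : M, TangentSpace 𝓘(ℝ, E) x} {x : M} (hX : MDiffAt (T% X) x)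
    (hY : MDiffAt (T% Y) x) (hY' : MDiffAt (T% Y') x) (hZ : MDiffAt (T% Z) x) :
    koszul X (Y + Y') Z x = koszul X Y Z x + koszul X Y' Z x := by
  have h1 : (fun y ↦ ⟪(Y + Y') y, Z y⟫_ℝ) = fun y ↦ ⟪Y y, Z y⟫_ℝ + ⟪Y' y, Z y⟫_ℝ := by
    funext y; simp [inner_add_left]
  have h2 : (fun y ↦ ⟪X y, (Y + Y') y⟫_ℝ) = fun y ↦ ⟪X y, Y y⟫_ℝ + ⟪X y, Y' y⟫_ℝ := by
    funext y; simp [inner_add_right]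
  simp only [koszul, h1, h2, mvfderiv_fun_add (mdiffAt_inner hY hZ) (mdiffAt_inner hY' hZ),
    mvfderiv_fun_add (mdiffAt_inner hX hY) (mdiffAt_inner hX hY'), mlieBracket_add_left hY hY',
    mlieBracket_add_right hY hY']
  simp [inner_add_left, inner_add_right]
  ring

theorem koszul_smul {X Y Z : Π x : M, TangentSpace 𝓘(ℝ, E) x} {f : M → ℝ} {x : M}
    (hX : MDiffAt (T% X) x) (hY : MDiffAt (T% Y) x) (hZ : MDiffAt (T% Z) x) (hf : MDiffAt f x) :
    koszul X (f • Y) Z x = f x * koszul X Y Z x + 2 * (d% f x (X x) * ⟪Y x, Z x⟫_ℝ) := by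
  have h1 : (fun y ↦ ⟪(f • Y) y, Z y⟫_ℝ) = fun y ↦ f y * ⟪Y y, Z y⟫_ℝ := by
    funext y; simp [inner_smul_left]
  have h2 : (fun y ↦ ⟪X y, (f • Y) y⟫_ℝ) = fun y ↦ f y * ⟪X y, Y y⟫_ℝ := by
    funext y; simp [inner_smul_right]
  simp only [koszul, h1, h2, mvfderiv_fun_mul hf (mdiffAt_inner hY hZ),
    mvfderiv_fun_mul hf (mdiffAt_inner hX hY), mlieBracket_smul_left hf hY,
    mlieBracket_smul_right hf hY]
  simp [inner_add_left, inner_smul_left, inner_smul_right, real_inner_comm]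
  ring

variable (E M) in
/-- The Levi-Civita connection of a Riemannian manifold: `leviCivita E M Y x v` is `∇_v Y` at `x`,
for a vector field `Y` and a tangent vector `v` at `x`. -/
def leviCivita : CovariantDerivative 𝓘(ℝ, E) E (fun x : M ↦ TangentSpace 𝓘(ℝ, E) x) where
  toFun := leviCivitaAux
  isCovariantDerivativeOnUniv :=
    { add := fun {Y Y' x} hY hY' _ ↦ by
        ext v
        refine tangent_ext fun Z hZ ↦ ?_
        have hv : MDiffAt (T% (extend E v)) x := mdifferentiableAt_extend ..
        have hs : MDiffAt (T% (Y + Y')) x := mdifferentiableAt_add_section hY hY'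
        have h0 := inner_leviCivitaAux hv hs hZ
        have h1 := inner_leviCivitaAux hv hY hZ
        have h2 := inner_leviCivitaAux hv hY' hZ
        rw [extend_apply_self] at h0 h1 h2
        rw [h0, koszul_add hv hY hY' hZ, add_apply, inner_add_left, h1, h2]
        ring
      leibniz := fun {Y f x} hY hf _ ↦ by
        ext v
        refine tangent_ext fun Z hZ ↦ ?_
        have hv : MDiffAt (T% (extend E v)) x := mdifferentiableAt_extend ..
        have hs : MDiffAt (T% (f • Y)) x := hf.smul_section hY
        have h0 := inner_leviCivitaAux hv hs hZ
        have h1 := inner_leviCivitaAux hv hY hZ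
        rw [extend_apply_self] at h0 h1
        rw [h0, koszul_smul hv hY hZ hf, add_apply, inner_add_left,
          smul_apply, inner_smul_left, h1]
        simp [inner_smul_left]
        ring }

theorem inner_leviCivita {X Y Z : Π x : M, TangentSpace 𝓘(ℝ, E) x} {x : M}
    (hX : MDiffAt (T% X) x) (hY : MDiffAt (T% Y) x) (hZ : MDiffAt (T% Z) x) :
    ⟪leviCivita E M Y x (X x), Z x⟫_ℝ = (1 / 2) * koszul X Y Z x :=
  inner_leviCivitaAux hX hY hZ

/-- The Levi-Civita connection is torsion free. -/
theorem leviCivita_torsion {X Y : Π x : M, TangentSpace 𝓘(ℝ, E) x} {x : M}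
    (hX : MDiffAt (T% X) x) (hY : MDiffAt (T% Y) x) :
    leviCivita E M Y x (X x) - leviCivita E M X x (Y x) = mlieBracket 𝓘(ℝ, E) X Y x := by
  refine tangent_ext fun Z hZ ↦ ?_
  rw [inner_sub_left, inner_leviCivita hX hY hZ, inner_leviCivita hY hX hZ]
  have hc : (fun y ↦ ⟪Y y, X y⟫_ℝ) = fun y ↦ ⟪X y, Y y⟫_ℝ := by
    funext y; exact real_inner_comm _ _
  have hb : mlieBracket 𝓘(ℝ, E) Y X x = - mlieBracket 𝓘(ℝ, E) X Y x := mlieBracket_swap_apply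
  simp only [koszul, hc, hb, inner_neg_left]
  ring

/-- The Levi-Civita connection is compatible with the metric. -/
theorem leviCivita_metric {X Y Z : Π x : M, TangentSpace 𝓘(ℝ, E) x} {x : M}
    (hX : MDiffAt (T% X) x) (hY : MDiffAt (T% Y) x) (hZ : MDiffAt (T% Z) x) :
    d% (fun y ↦ ⟪Y y, Z y⟫_ℝ) x (X x) =
      ⟪leviCivita E M Y x (X x), Z x⟫_ℝ + ⟪Y x, leviCivita E M Z x (X x)⟫_ℝ := by
  rw [real_inner_comm (leviCivita E M Z x (X x)) (Y x), inner_leviCivita hX hY hZ,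
    inner_leviCivita hX hZ hY]
  have hc (A B : Π x : M, TangentSpace 𝓘(ℝ, E) x) :
      (fun y ↦ ⟪A y, B y⟫_ℝ) = fun y ↦ ⟪B y, A y⟫_ℝ := by
    funext y; exact real_inner_comm _ _
  have hb : mlieBracket 𝓘(ℝ, E) Z Y x = - mlieBracket 𝓘(ℝ, E) Y Z x := mlieBracket_swap_apply
  simp only [koszul, hc Z Y, hb, inner_neg_left]
  ring
end LeviCivita

section Tensors

variable {E : Type*} [NormedAddCommGroup E] [NormedSpace ℝ E] [FiniteDimensional ℝ E]
  {M : Type*} [TopologicalSpace M] [ChartedSpace E M] [IsManifold 𝓘(ℝ, E) ∞ M]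
  [RiemannianBundle (fun x : M ↦ TangentSpace 𝓘(ℝ, E) x)]
  [IsContMDiffRiemannianBundle 𝓘(ℝ, E) ∞ E (fun x : M ↦ TangentSpace 𝓘(ℝ, E) x)]

/-- The gradient of a function on a Riemannian manifold: `⟪grad f, v⟫ = df(v)`. -/
def riemannianGradient (f : M → ℝ) (x : M) : TangentSpace 𝓘(ℝ, E) x :=
  haveI : CompleteSpace (TangentSpace 𝓘(ℝ, E) x) := FiniteDimensional.complete ℝ _
  (InnerProductSpace.toDual ℝ (TangentSpace 𝓘(ℝ, E) x)).symm (d% f x)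

/-- `X` is a smooth vector field on the set `U` (its values outside `U` are irrelevant). -/
def IsSmoothFieldOn (X : Π x : M, TangentSpace 𝓘(ℝ, E) x) (U : Set M) : Prop :=
  CMDiff[U] ∞ (T% X)

/-- `X` is a smooth section over `U` of the family of subspaces `D`. -/
def IsSectionOn (D : Π x : M, Submodule ℝ (TangentSpace 𝓘(ℝ, E) x))
    (X : Π x : M, TangentSpace 𝓘(ℝ, E) x) (U : Set M) : Prop :=
  IsSmoothFieldOn X U ∧ ∀ x ∈ U, X x ∈ D x

/-- `D` is a (smooth) distribution on `U`: near each point of `U` it is spanned by a smooth frame. -/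
def IsDistributionOn (D : Π x : M, Submodule ℝ (TangentSpace 𝓘(ℝ, E) x)) (U : Set M) : Prop :=
  ∀ p ∈ U, ∃ (W : Set M) (k : ℕ) (s : Fin k → Π x : M, TangentSpace 𝓘(ℝ, E) x),
    IsOpen W ∧ p ∈ W ∧ W ⊆ U ∧ (∀ i, IsSmoothFieldOn (s i) W) ∧
      ∀ x ∈ W, LinearIndependent ℝ (fun i ↦ s i x) ∧
        Submodule.span ℝ (Set.range fun i ↦ s i x) = D x

/-- The distribution `D` is integrable (involutive) on `U`: it is closed under Lie brackets. -/
def IsIntegrableOn (D : Π x : M, Submodule ℝ (TangentSpace 𝓘(ℝ, E) x)) (U : Set M) : Prop :=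
  ∀ X Y : Π x : M, TangentSpace 𝓘(ℝ, E) x, IsSectionOn D X U → IsSectionOn D Y U →
    ∀ x ∈ U, mlieBracket 𝓘(ℝ, E) X Y x ∈ D x

end Tensors

section Quaternionic

variable {E : Type*} [NormedAddCommGroup E] [NormedSpace ℝ E] [FiniteDimensional ℝ E]
  {M : Type*} [TopologicalSpace M] [ChartedSpace E M] [IsManifold 𝓘(ℝ, E) ∞ M]
  [RiemannianBundle (fun x : M ↦ TangentSpace 𝓘(ℝ, E) x)]
  [IsContMDiffRiemannianBundle 𝓘(ℝ, E) ∞ E (fun x : M ↦ TangentSpace 𝓘(ℝ, E) x)]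

/-- The endomorphism field `J` is smooth on `U`. -/
def IsSmoothEndOn (J : Π x : M, TangentSpace 𝓘(ℝ, E) x →L[ℝ] TangentSpace 𝓘(ℝ, E) x)
    (U : Set M) : Prop :=
  letI σ (x : M) : TotalSpace (E →L[ℝ] E)
      (fun x : M ↦ TangentSpace 𝓘(ℝ, E) x →L[ℝ] TangentSpace 𝓘(ℝ, E) x) := ⟨x, J x⟩
  ContMDiffOn 𝓘(ℝ, E) (𝓘(ℝ, E).prod 𝓘(ℝ, E →L[ℝ] E)) ∞ σ U

/-- `(J 0, J 1, J 2)` is a quaternionic Hermitian basis over `U` of sections of the bundle `Q` of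
endomorphisms of the tangent bundle. The indices are taken modulo `3`. -/
structure IsQuaternionicHermitianBasis
    (Q : Π x : M, Submodule ℝ (TangentSpace 𝓘(ℝ, E) x →L[ℝ] TangentSpace 𝓘(ℝ, E) x))
    (J : Fin 3 → Π x : M, TangentSpace 𝓘(ℝ, E) x →L[ℝ] TangentSpace 𝓘(ℝ, E) x)
    (U : Set M) : Prop where
  smooth : ∀ α, IsSmoothEndOn (J α) U
  linearIndependent : ∀ x ∈ U, LinearIndependent ℝ (fun α ↦ J α x)
  span_eq : ∀ x ∈ U, Submodule.span ℝ (Set.range fun α ↦ J α x) = Q x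
  sq : ∀ α, ∀ x ∈ U, ∀ v, J α x (J α x v) = -v
  mul : ∀ α, ∀ x ∈ U, ∀ v, J α x (J (α + 1) x v) = J (α + 2) x v
  mul_swap : ∀ α, ∀ x ∈ U, ∀ v, J (α + 1) x (J α x v) = -J (α + 2) x v
  isometry : ∀ α, ∀ x ∈ U, ∀ v w, ⟪J α x v, J α x w⟫_ℝ = ⟪v, w⟫_ℝ

/-- The `1`-forms `om α` on `U` are the connection forms of the basis `J`:
`∇_v J_α = om_{α+2}(v) J_{α+1} - om_{α+1}(v) J_{α+2}`, where
`(∇_v J) Y = ∇_v (J Y) - J (∇_v Y)`. -/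
structure IsQuaternionicConnectionForms
    (J : Fin 3 → Π x : M, TangentSpace 𝓘(ℝ, E) x →L[ℝ] TangentSpace 𝓘(ℝ, E) x)
    (om : Fin 3 → Π x : M, TangentSpace 𝓘(ℝ, E) x →L[ℝ] ℝ) (U : Set M) : Prop where
  smooth : ∀ α, ∀ X : Π x : M, TangentSpace 𝓘(ℝ, E) x, IsSmoothFieldOn X U →
    ContMDiffOn 𝓘(ℝ, E) 𝓘(ℝ, ℝ) ∞ (fun x ↦ om α x (X x)) U
  nabla_eq : ∀ α, ∀ Y : Π x : M, TangentSpace 𝓘(ℝ, E) x, IsSmoothFieldOn Y U →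
    ∀ x ∈ U, ∀ v : TangentSpace 𝓘(ℝ, E) x,
      leviCivita E M (fun y ↦ J α y (Y y)) x v - J α x (leviCivita E M Y x v) =
        om (α + 2) x v • J (α + 1) x (Y x) - om (α + 1) x v • J (α + 2) x (Y x)

/-- `(M, Q, g)` is a quaternionic Kähler manifold: near each point, the bundle `Q` of endomorphisms
has a quaternionic Hermitian basis with connection forms. -/
def IsQuaternionicKahler
    (Q : Π x : M, Submodule ℝ (TangentSpace 𝓘(ℝ, E) x →L[ℝ] TangentSpace 𝓘(ℝ, E) x)) : Prop :=
  ∀ p : M, ∃ U : Set M, IsOpen U ∧ p ∈ U ∧ ∃ J om,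
    IsQuaternionicHermitianBasis Q J U ∧ IsQuaternionicConnectionForms J om U

end Quaternionic

section Submersion

variable {E : Type*} [NormedAddCommGroup E] [NormedSpace ℝ E] [FiniteDimensional ℝ E]
  {M : Type*} [TopologicalSpace M] [ChartedSpace E M] [IsManifold 𝓘(ℝ, E) ∞ M]
  [RiemannianBundle (fun x : M ↦ TangentSpace 𝓘(ℝ, E) x)]
  [IsContMDiffRiemannianBundle 𝓘(ℝ, E) ∞ E (fun x : M ↦ TangentSpace 𝓘(ℝ, E) x)]
  {E' : Type*} [NormedAddCommGroup E'] [NormedSpace ℝ E'] [FiniteDimensional ℝ E']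
  {N : Type*} [TopologicalSpace N] [ChartedSpace E' N] [IsManifold 𝓘(ℝ, E') ∞ N]
  [RiemannianBundle (fun y : N ↦ TangentSpace 𝓘(ℝ, E') y)]
  [IsContMDiffRiemannianBundle 𝓘(ℝ, E') ∞ E' (fun y : N ↦ TangentSpace 𝓘(ℝ, E') y)]

/-- The connection induced on the pull-back bundle `F⁻¹TN` by the Levi-Civita connection of `N`:
`pullbackNabla F s x v` is `∇^N_v s` at `x`, for a section `s` of `F⁻¹TN`. In the frame
`(e_a)` of `TN` near `F x` given by the preferred trivialization, `s = ∑ s^a (e_a ∘ F)` and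
`∇^N_v s = ∑ v(s^a) e_a + ∑ s^a(x) ∇_{F_* v} e_a`; the second sum is the derivative of the field
`∑ s^a(x) e_a`, which is `FiberBundle.extend E' (s x)`. -/
def pullbackNabla (F : M → N) (s : Π x : M, TangentSpace 𝓘(ℝ, E') (F x)) (x : M)
    (v : TangentSpace 𝓘(ℝ, E) x) : TangentSpace 𝓘(ℝ, E') (F x) :=
  letI t := trivializationAt E' (fun y : N ↦ TangentSpace 𝓘(ℝ, E') y) (F x)
  t.symm (F x) ((d% (fun z : M ↦ (t ⟨F z, s z⟩).2) x) v)
    + leviCivita E' N (extend E' (s x)) (F x) (mfderiv 𝓘(ℝ, E) 𝓘(ℝ, E') F x v)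

/-- The vertical space `ker F_*` at `x`. -/
def vertical (F : M → N) (x : M) : Submodule ℝ (TangentSpace 𝓘(ℝ, E) x) :=
  (mfderiv 𝓘(ℝ, E) 𝓘(ℝ, E') F x).toLinearMap.ker

/-- The horizontal space `(ker F_*)ᗮ` at `x`. -/
def horizontal (F : M → N) (x : M) : Submodule ℝ (TangentSpace 𝓘(ℝ, E) x) :=
  (vertical (E := E) (E' := E') F x)ᗮ

/-- The orthogonal projection `𝒱` onto the vertical space. -/
def vProj (F : M → N) (x : M) (v : TangentSpace 𝓘(ℝ, E) x) : TangentSpace 𝓘(ℝ, E) x :=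
  (vertical (E := E) (E' := E') F x).starProjection v

/-- The orthogonal projection `ℋ` onto the horizontal space. -/
def hProj (F : M → N) (x : M) (v : TangentSpace 𝓘(ℝ, E) x) : TangentSpace 𝓘(ℝ, E) x :=
  (horizontal (E := E) (E' := E') F x).starProjection v

/-- O'Neill's tensor `𝒜_X Y = ℋ ∇_{ℋ X} 𝒱 Y + 𝒱 ∇_{ℋ X} ℋ Y`. -/
def oneillA (F : M → N) (X Y : Π x : M, TangentSpace 𝓘(ℝ, E) x) (x : M) :
    TangentSpace 𝓘(ℝ, E) x :=
  hProj (E' := E') F x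
      (leviCivita E M (fun y ↦ vProj (E' := E') F y (Y y)) x (hProj (E' := E') F x (X x)))
    + vProj (E' := E') F x
      (leviCivita E M (fun y ↦ hProj (E' := E') F y (Y y)) x (hProj (E' := E') F x (X x)))

/-- `F` is a horizontally conformal submersion from `M` onto `N` with dilation `lam`. -/
structure IsHConformalSubmersion (F : M → N) (lam : M → ℝ) : Prop where
  finrank_lt : Module.finrank ℝ E' < Module.finrank ℝ E
  contMDiff : ContMDiff 𝓘(ℝ, E) 𝓘(ℝ, E') ∞ F
  surjective : Function.Surjective F
  submersion : ∀ x, Function.Surjective (mfderiv 𝓘(ℝ, E) 𝓘(ℝ, E') F x)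
  lam_contMDiff : ContMDiff 𝓘(ℝ, E) 𝓘(ℝ, ℝ) ∞ lam
  lam_pos : ∀ x, 0 < lam x
  conformal : ∀ x, ∀ v ∈ horizontal (E := E) (E' := E') F x,
    ∀ w ∈ horizontal (E := E) (E' := E') F x,
      ⟪mfderiv 𝓘(ℝ, E) 𝓘(ℝ, E') F x v, mfderiv 𝓘(ℝ, E) 𝓘(ℝ, E') F x w⟫_ℝ = lam x ^ 2 * ⟪v, w⟫_ℝ

/-- `F`, with dilation `lam`, is `h`-homothetic on `U`: `ℋ(grad lam) = 0` on `U`. -/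
def IsHHomotheticOn (F : M → N) (lam : M → ℝ) (U : Set M) : Prop :=
  ∀ x ∈ U, hProj (E := E) (E' := E') F x (riemannianGradient lam x) = 0

/-- The orthogonal complement `𝒟₂` of `𝒟₁` in `ker F_*`. -/
def distTwo (F : M → N) (D₁ : Π x : M, Submodule ℝ (TangentSpace 𝓘(ℝ, E) x)) (x : M) :
    Submodule ℝ (TangentSpace 𝓘(ℝ, E) x) :=
  vertical (E := E) (E' := E') F x ⊓ (D₁ x)ᗮ

/-- The orthogonal complement `μ` of `J 𝒟₂` in `(ker F_*)ᗮ`. -/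
def distMu (F : M → N) (J : Π x : M, TangentSpace 𝓘(ℝ, E) x →L[ℝ] TangentSpace 𝓘(ℝ, E) x)
    (D₁ : Π x : M, Submodule ℝ (TangentSpace 𝓘(ℝ, E) x)) (x : M) :
    Submodule ℝ (TangentSpace 𝓘(ℝ, E) x) :=
  horizontal (E := E) (E' := E') F x ⊓ ((distTwo (E' := E') F D₁ x).map (J x).toLinearMap)ᗮ

/-- `J` is an almost `h`-conformal semi-invariant basis over `U`, with the distributions
`D₁ α = 𝒟₁^{J_α} ⊆ ker F_*`. -/
structure IsAlmostSemiInvariantBasis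
    (Q : Π x : M, Submodule ℝ (TangentSpace 𝓘(ℝ, E) x →L[ℝ] TangentSpace 𝓘(ℝ, E) x)) (F : M → N)
    (J : Fin 3 → Π x : M, TangentSpace 𝓘(ℝ, E) x →L[ℝ] TangentSpace 𝓘(ℝ, E) x)
    (D₁ : Fin 3 → Π x : M, Submodule ℝ (TangentSpace 𝓘(ℝ, E) x)) (U : Set M) : Prop where
  basis : IsQuaternionicHermitianBasis Q J U
  distribution : ∀ α, IsDistributionOn (D₁ α) U
  le_vertical : ∀ α, ∀ x ∈ U, D₁ α x ≤ vertical (E := E) (E' := E') F x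
  map_eq : ∀ α, ∀ x ∈ U, (D₁ α x).map (J α x).toLinearMap = D₁ α x
  map_le : ∀ α, ∀ x ∈ U, (distTwo (E' := E') F (D₁ α) x).map (J α x).toLinearMap ≤
    horizontal (E := E) (E' := E') F x

/-- `F` is an almost `h`-conformal semi-invariant submersion with dilation `lam`. -/
structure IsAlmostHConformalSemiInvariant
    (Q : Π x : M, Submodule ℝ (TangentSpace 𝓘(ℝ, E) x →L[ℝ] TangentSpace 𝓘(ℝ, E) x)) (F : M → N)
    (lam : M → ℝ) : Prop where
  hConformal : IsHConformalSubmersion (E := E) (E' := E') F lam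
  exists_basis : ∀ p : M, ∃ U : Set M, IsOpen U ∧ p ∈ U ∧ ∃ J D₁,
    IsAlmostSemiInvariantBasis (E' := E') Q F J D₁ U

/-- `B_J X = 𝒱(J X)`. -/
def compB (F : M → N) (J : Π x : M, TangentSpace 𝓘(ℝ, E) x →L[ℝ] TangentSpace 𝓘(ℝ, E) x)
    (X : Π x : M, TangentSpace 𝓘(ℝ, E) x) (x : M) : TangentSpace 𝓘(ℝ, E) x :=
  vProj (E' := E') F x (J x (X x))

/-- `C_J X = ℋ(J X)`. -/
def compC (F : M → N) (J : Π x : M, TangentSpace 𝓘(ℝ, E) x →L[ℝ] TangentSpace 𝓘(ℝ, E) x)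
    (X : Π x : M, TangentSpace 𝓘(ℝ, E) x) (x : M) : TangentSpace 𝓘(ℝ, E) x :=
  hProj (E' := E') F x (J x (X x))

/-- The identity attached to `J_α`, over `U`: for all `X, Y ∈ Γ((ker F_*)ᗮ)` and
`V ∈ Γ(𝒟₂^{J_α})`,
`lam⁻² g_N(∇^N_Y F_* C_{J_α} X - ∇^N_X F_* C_{J_α} Y, F_* J_α V)
  = g_M(𝒜_X B_{J_α} Y - 𝒜_Y B_{J_α} X, J_α V)
    + om_{α+2}(Y) g_M(C_{J_{α+1}} X, J_α V) - om_{α+1}(Y) g_M(C_{J_{α+2}} X, J_α V)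
    - om_{α+2}(X) g_M(C_{J_{α+1}} Y, J_α V) + om_{α+1}(X) g_M(C_{J_{α+2}} Y, J_α V)`. -/
def HomotheticIdentityOn (F : M → N) (lam : M → ℝ)
    (J : Fin 3 → Π x : M, TangentSpace 𝓘(ℝ, E) x →L[ℝ] TangentSpace 𝓘(ℝ, E) x)
    (D₁ : Fin 3 → Π x : M, Submodule ℝ (TangentSpace 𝓘(ℝ, E) x))
    (om : Fin 3 → Π x : M, TangentSpace 𝓘(ℝ, E) x →L[ℝ] ℝ) (U : Set M) (α : Fin 3) : Prop :=
  ∀ X Y V : Π x : M, TangentSpace 𝓘(ℝ, E) x,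
    IsSectionOn (horizontal (E := E) (E' := E') F) X U →
    IsSectionOn (horizontal (E := E) (E' := E') F) Y U →
    IsSectionOn (distTwo (E' := E') F (D₁ α)) V U →
    ∀ x ∈ U,
      (lam x ^ 2)⁻¹ *
          ⟪pullbackNabla (E := E) (E' := E') F
              (fun y ↦ mfderiv 𝓘(ℝ, E) 𝓘(ℝ, E') F y (compC (E' := E') F (J α) X y)) x (Y x)
            - pullbackNabla (E := E) (E' := E') F
              (fun y ↦ mfderiv 𝓘(ℝ, E) 𝓘(ℝ, E') F y (compC (E' := E') F (J α) Y y)) x (X x),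
            mfderiv 𝓘(ℝ, E) 𝓘(ℝ, E') F x (J α x (V x))⟫_ℝ =
        ⟪oneillA (E' := E') F X (compB (E' := E') F (J α) Y) x
            - oneillA (E' := E') F Y (compB (E' := E') F (J α) X) x, J α x (V x)⟫_ℝ
          + om (α + 2) x (Y x) * ⟪compC (E' := E') F (J (α + 1)) X x, J α x (V x)⟫_ℝ
          - om (α + 1) x (Y x) * ⟪compC (E' := E') F (J (α + 2)) X x, J α x (V x)⟫_ℝ
          - om (α + 2) x (X x) * ⟪compC (E' := E') F (J (α + 1)) Y x, J α x (V x)⟫_ℝ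
          + om (α + 1) x (X x) * ⟪compC (E' := E') F (J (α + 2)) Y x, J α x (V x)⟫_ℝ

end Submersion

end

set_option linter.unusedSectionVars false

noncomputable section

/-! ### Derivatives along vector fields, read in a chart -/

section Derivatives

variable {E : Type*} [NormedAddCommGroup E] [NormedSpace ℝ E] [FiniteDimensional ℝ E]
  {M : Type*} [TopologicalSpace M] [ChartedSpace E M] [IsManifold 𝓘(ℝ, E) ∞ M]
  {G : Type*} [NormedAddCommGroup G] [NormedSpace ℝ G]

/-! Write J = J_α, B, C for its vertical and horizontal parts, and g = g_M. The core is that, when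
the horizontal distribution is integrable, the two sides of (I_α) differ exactly by λ⁻¹ (dλ(CX) g(Y,
JV) - dλ(CY) g(X, JV) - 2 dλ(JV) g(Y, JX)), which is
`IsHConformalSubmersion.homotheticIdentity_defect`.

To see this, note that the connection along F is metric (`pullbackNabla_metric`) and torsion free
(`pullbackNabla_mfderiv_sub`). With conformality, Koszul's argument gives, for horizontal X, Y, Z,
g_N(∇^N_X F_*Y, F_*Z) = λ² g(∇_X Y, Z) + λ (dλ(X) g(Y, Z) + dλ(Y) g(X, Z) - dλ(Z) g(X, Y)), which is
`IsHConformalSubmersion.inner_pullbackNabla`. It is used with CX in place of the differentiated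
field and JV as test field. The derivative of CX is that of JX minus that of BX. The former produces
the ω-terms and g(∇_Y X, V), the latter the 𝒜-terms. After antisymmetrization in X and Y, what is
left of the Levi-Civita terms is g([Y, X], V), which vanishes by integrability.

The defect involves dλ on horizontal vectors only, so an h-homothetic F satisfies every (I_α).
Conversely, the defect is tensorial, and every horizontal vector and every vector of 𝒟₂ extends to a
section, so (I_α) makes it vanish for all vectors at a point. J preserves μ
(`IsAlmostSemiInvariantBasis.map_distMu`). A nonzero m in μ, with X = m and Y = Jm, forces dλ(JV) =
0 for all V in 𝒟₂. A nonzero v in 𝒟₂, with X = Jm, Y = Jv and V = v, then forces dλ(m) = 0 for all m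
in μ. As (ker F_*)ᗮ = J𝒟₂ ⊕ μ, dλ vanishes on horizontal vectors. -/

theorem Filter.EventuallyEq.mvfderiv_eq {f g : M → G} {x : M} (h : f =ᶠ[𝓝 x] g) :
    (d% f x : TangentSpace 𝓘(ℝ, E) x →L[ℝ] G) = d% g x := by
  ext v
  change mfderiv 𝓘(ℝ, E) 𝓘(ℝ, G) f x v = mfderiv 𝓘(ℝ, E) 𝓘(ℝ, G) g x v
  rw [h.mfderiv_eq]
  rfl

/-- A vector field read in the preferred chart at `x`. -/
def fieldInChart (x : M) (X : Π x : M, TangentSpace 𝓘(ℝ, E) x) (u : E) : E :=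
  mpullbackWithin 𝓘(ℝ, E) 𝓘(ℝ, E) (extChartAt 𝓘(ℝ, E) x).symm X (Set.range 𝓘(ℝ, E)) u

theorem range_self_model : Set.range 𝓘(ℝ, E) = Set.univ := by simp

theorem differentiableAt_fieldInChart {X : Π x : M, TangentSpace 𝓘(ℝ, E) x} {x : M}
    (hX : MDiffAt (T% X) x) :
    DifferentiableAt ℝ (fieldInChart x X) (extChartAt 𝓘(ℝ, E) x x) := by
  have h := MDifferentiableWithinAt.differentiableWithinAt_mpullbackWithin_vectorField
    (mdifferentiableWithinAt_univ.2 hX)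
  rw [Set.preimage_univ, Set.univ_inter] at h
  exact h.differentiableAt (by rw [range_self_model]; exact Filter.univ_mem)

theorem fieldInChart_self (X : Π x : M, TangentSpace 𝓘(ℝ, E) x) (x : M) :
    fieldInChart x X (extChartAt 𝓘(ℝ, E) x x) = X x := by
  have h := mfderivWithin_extChartAt_symm_inverse_apply (I := 𝓘(ℝ, E)) (X x)
  unfold fieldInChart mpullbackWithin
  rw [extChartAt_to_inv x]
  exact h

theorem mfderiv_fieldInChart (X : Π x : M, TangentSpace 𝓘(ℝ, E) x) {x : M} {u : E}
    (hu : u ∈ (extChartAt 𝓘(ℝ, E) x).target) :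
    mfderivWithin 𝓘(ℝ, E) 𝓘(ℝ, E) (extChartAt 𝓘(ℝ, E) x).symm (Set.range 𝓘(ℝ, E)) u
      (fieldInChart (E := E) x X u : E) = X ((extChartAt 𝓘(ℝ, E) x).symm u) := by
  exact ContinuousLinearMap.ext_iff.1
    (isInvertible_mfderivWithin_extChartAt_symm hu).self_comp_inverse
    (X ((extChartAt 𝓘(ℝ, E) x).symm u))

/-- The chain rule in the chart at `x`. It holds on a neighbourhood and not only at `x`, so that
both sides can be differentiated once more. -/
theorem mvfderiv_apply_eq_fderiv_fieldInChart {f : M → G} {x : M} (hf : CMDiffAt 1 f x)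
    (X : Π x : M, TangentSpace 𝓘(ℝ, E) x) :
    (fun z ↦ d% f z (X z)) =ᶠ[𝓝 x] fun z ↦
      fderiv ℝ (f ∘ (extChartAt 𝓘(ℝ, E) x).symm) (extChartAt 𝓘(ℝ, E) x z)
        (fieldInChart x X (extChartAt 𝓘(ℝ, E) x z)) := by
  have hf' : ∀ᶠ z in 𝓝 x, CMDiffAt 1 f z := (contMDiffAt_iff_contMDiffAt_nhds (by simp)).1 hf
  filter_upwards [hf', extChartAt_source_mem_nhds (I := 𝓘(ℝ, E)) x] with z hz hzs
  have hu := (extChartAt 𝓘(ℝ, E) x).map_source hzs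
  set u := extChartAt 𝓘(ℝ, E) x z with hu'
  have hz' : (extChartAt 𝓘(ℝ, E) x).symm u = z := (extChartAt 𝓘(ℝ, E) x).left_inv hzs
  have h2 := mdifferentiableWithinAt_extChartAt_symm hu
  have h1 : MDifferentiableAt 𝓘(ℝ, E) 𝓘(ℝ, G) f ((extChartAt 𝓘(ℝ, E) x).symm u) := by
    rw [hz']; exact hz.mdifferentiableAt one_ne_zero
  have h3 := mfderiv_comp_mfderivWithin u h1 h2 (𝓘(ℝ, E).uniqueMDiffOn u (by simp))
  rw [mfderivWithin_eq_fderivWithin, range_self_model, fderivWithin_univ] at h3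
  have h4 := mfderiv_fieldInChart X hu
  rw [range_self_model] at h4
  change mfderiv 𝓘(ℝ, E) 𝓘(ℝ, G) f z (X z) = _
  rw [h3]
  change _ = mfderiv 𝓘(ℝ, E) 𝓘(ℝ, G) f ((extChartAt 𝓘(ℝ, E) x).symm u) (_)
  refine Eq.trans ?_ (congrArg (mfderiv 𝓘(ℝ, E) 𝓘(ℝ, G) f ((extChartAt 𝓘(ℝ, E) x).symm u)) h4.symm)
  rw [hz']

theorem mdifferentiableAt_comp_extChartAt {h : E → G} {x : M}
    (hh : DifferentiableAt ℝ h (extChartAt 𝓘(ℝ, E) x x)) :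
    MDiffAt (fun z ↦ h (extChartAt 𝓘(ℝ, E) x z)) x :=
  hh.mdifferentiableAt.comp x (mdifferentiableAt_extChartAt (by simp))

theorem mvfderiv_comp_extChartAt {h : E → G} {x : M}
    (hh : DifferentiableAt ℝ h (extChartAt 𝓘(ℝ, E) x x)) (v : TangentSpace 𝓘(ℝ, E) x) :
    d% (fun z ↦ h (extChartAt 𝓘(ℝ, E) x z)) x v = fderiv ℝ h (extChartAt 𝓘(ℝ, E) x x) v := by
  have h1 := mfderiv_comp x hh.mdifferentiableAt
    (mdifferentiableAt_extChartAt (I := 𝓘(ℝ, E)) (x := x) (by simp))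
  rw [mfderiv_eq_fderiv, mfderiv_extChartAt_self] at h1
  change mfderiv 𝓘(ℝ, E) 𝓘(ℝ, G) (h ∘ extChartAt 𝓘(ℝ, E) x) x v = _
  rw [h1]
  rfl

theorem contDiffAt_comp_extChartAt_symm {f : M → G} {x : M} {n : WithTop ℕ∞}
    (hf : CMDiffAt n f x) :
    ContDiffAt ℝ n (f ∘ (extChartAt 𝓘(ℝ, E) x).symm) (extChartAt 𝓘(ℝ, E) x x) := by
  have h := (contMDiffAt_iff.1 hf).2
  rw [range_self_model, contDiffWithinAt_univ] at h
  exact h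

/-- The product rule for the chart expression Df · Y. The Hessian term is kept apart because its
symmetry will cancel it from commutators. -/
theorem mdifferentiableAt_mvfderiv_apply {f : M → G} {x : M} (hf : CMDiffAt 2 f x)
    {Y : Π x : M, TangentSpace 𝓘(ℝ, E) x} (hY : MDiffAt (T% Y) x) :
    MDiffAt (fun z ↦ d% f z (Y z)) x ∧ ∀ v : TangentSpace 𝓘(ℝ, E) x,
      d% (fun z ↦ d% f z (Y z)) x v =
        fderiv ℝ (fderiv ℝ (f ∘ (extChartAt 𝓘(ℝ, E) x).symm)) (extChartAt 𝓘(ℝ, E) x x) v (Y x) +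
        fderiv ℝ (f ∘ (extChartAt 𝓘(ℝ, E) x).symm) (extChartAt 𝓘(ℝ, E) x x)
          (fderiv ℝ (fieldInChart x Y) (extChartAt 𝓘(ℝ, E) x x) v) := by
  have h0 := mvfderiv_apply_eq_fderiv_fieldInChart (hf.of_le one_le_two) Y
  have h1 : DifferentiableAt ℝ (fderiv ℝ (f ∘ (extChartAt 𝓘(ℝ, E) x).symm))
      (extChartAt 𝓘(ℝ, E) x x) :=
    ((contDiffAt_comp_extChartAt_symm hf).fderiv_right
      (m := 1) (by norm_num)).differentiableAt one_ne_zero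
  have h2 := differentiableAt_fieldInChart hY
  have h3 := h1.clm_apply h2
  refine ⟨(mdifferentiableAt_comp_extChartAt h3).congr_of_eventuallyEq h0, fun v ↦ ?_⟩
  rw [h0.mvfderiv_eq, mvfderiv_comp_extChartAt h3, fderiv_clm_apply h1 h2, fieldInChart_self]
  exact add_comm _ _

theorem mlieBracket_eq_lieBracket_fieldInChart (X Y : Π x : M, TangentSpace 𝓘(ℝ, E) x) (x : M) :
    mlieBracket 𝓘(ℝ, E) X Y x =
      lieBracket ℝ (fieldInChart x X) (fieldInChart x Y) (extChartAt 𝓘(ℝ, E) x x) := by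
  rw [← mlieBracketWithin_univ, mlieBracketWithin_apply, mfderiv_extChartAt_self]
  -- The preferred chart at `x` has identity differential at `x` itself, so the inverse that pulls
  -- the bracket back disappears.
  refine (congrArg (fun A : E →L[ℝ] E ↦ A _) ContinuousLinearMap.inverse_id).trans ?_
  rw [Set.preimage_univ, Set.univ_inter]
  change lieBracketWithin ℝ (fieldInChart x X) (fieldInChart x Y) _ _ = _
  rw [range_self_model, lieBracketWithin_univ]

/-- The derivatives of a function along two vector fields commute up to the Lie bracket. -/
theorem mvfderiv_mvfderiv_sub {f : M → G} {x : M} (hf : CMDiffAt 2 f x)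
    {X Y : Π x : M, TangentSpace 𝓘(ℝ, E) x} (hX : MDiffAt (T% X) x) (hY : MDiffAt (T% Y) x) :
    d% (fun z ↦ d% f z (Y z)) x (X x) - d% (fun z ↦ d% f z (X z)) x (Y x) =
      d% f x (mlieBracket 𝓘(ℝ, E) X Y x) := by
  have hc := contDiffAt_comp_extChartAt_symm hf
  have hs : IsSymmSndFDerivAt ℝ (f ∘ (extChartAt 𝓘(ℝ, E) x).symm) (extChartAt 𝓘(ℝ, E) x x) :=
    hc.isSymmSndFDerivAt (by simp)
  -- The Hessian terms cancel by symmetry; the two remaining first-order terms form the coordinate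
  -- bracket.
  rw [(mdifferentiableAt_mvfderiv_apply hf hX).2, (mdifferentiableAt_mvfderiv_apply hf hY).2,
    hs.eq (Y x) (X x), add_sub_add_left_eq_sub, ← map_sub]
  have h0 := (mvfderiv_apply_eq_fderiv_fieldInChart (hf.of_le one_le_two)
    (mlieBracket 𝓘(ℝ, E) X Y)).self_of_nhds
  refine Eq.trans ?_ h0.symm
  beta_reduce
  rw [fieldInChart_self]
  congr 1
  rw [mlieBracket_eq_lieBracket_fieldInChart, lieBracket, fieldInChart_self, fieldInChart_self]

end Derivatives

/-! ### The connection along a map: torsion and metric -/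

section Pullback

variable {E : Type*} [NormedAddCommGroup E] [NormedSpace ℝ E] [FiniteDimensional ℝ E]
  {M : Type*} [TopologicalSpace M] [ChartedSpace E M] [IsManifold 𝓘(ℝ, E) ∞ M]
  {E' : Type*} [NormedAddCommGroup E'] [NormedSpace ℝ E'] [FiniteDimensional ℝ E']
  {N : Type*} [TopologicalSpace N] [ChartedSpace E' N] [IsManifold 𝓘(ℝ, E') ∞ N]

theorem mvfderiv_fun_sum {G : Type*} [NormedAddCommGroup G] [NormedSpace ℝ G] {ι : Type*}
    (t : Finset ι) {f : ι → M → G} {x : M} (hf : ∀ i, MDiffAt (f i) x) :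
    MDiffAt (fun z ↦ ∑ i ∈ t, f i z) x ∧
    (d% (fun z ↦ ∑ i ∈ t, f i z) x : TangentSpace 𝓘(ℝ, E) x →L[ℝ] G) = ∑ i ∈ t, d% (f i) x := by
  classical
  induction t using Finset.induction_on with
  | empty => 
    simp only [Finset.sum_empty]
    exact ⟨mdifferentiableAt_const, mvfderiv_const _⟩
  | insert a t ha ih =>
    simp only [Finset.sum_insert ha]
    exact ⟨(hf a).add ih.1, by rw [mvfderiv_fun_add (hf a) ih.1, ih.2]⟩

theorem trivializationAt_snd_eq_mvfderiv {x y : M} (hy : y ∈ (chartAt E x).source)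
    (v : TangentSpace 𝓘(ℝ, E) y) :
    (trivializationAt E (fun y : M ↦ TangentSpace 𝓘(ℝ, E) y) x ⟨y, v⟩).2 =
      d% (extChartAt 𝓘(ℝ, E) x) y v := by
  have h := TangentBundle.continuousLinearMapAt_trivializationAt (I := 𝓘(ℝ, E)) hy
  refine Eq.trans ?_ (ContinuousLinearMap.ext_iff.1 h v)
  rw [Trivialization.continuousLinearMapAt_apply, Trivialization.linearMapAt_apply]
  -- `linearMapAt` is zero by convention off the base set, hence the case distinction.
  exact (if_pos hy).symm

theorem extend_eq_symm {x : M} (v : TangentSpace 𝓘(ℝ, E) x) (y : M) :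
    extend E v y = (trivializationAt E (fun y : M ↦ TangentSpace 𝓘(ℝ, E) y) x).symm y
      (trivializationAt E (fun y : M ↦ TangentSpace 𝓘(ℝ, E) y) x ⟨x, v⟩).2 := rfl

/-- Canonical extensions have constant coordinates in the chart at `x`. Hence both iterated
derivatives of the chart map along them vanish, and so does its derivative along the bracket. -/
theorem mlieBracket_extend (x : M) (v w : TangentSpace 𝓘(ℝ, E) x) :
    mlieBracket 𝓘(ℝ, E) (extend E v) (extend E w) x = 0 := by
  have h (v : TangentSpace 𝓘(ℝ, E) x) : (fun z ↦ d% (extChartAt 𝓘(ℝ, E) x) z (extend E v z))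
      =ᶠ[𝓝 x] fun _ ↦ (trivializationAt E (fun y : M ↦ TangentSpace 𝓘(ℝ, E) y) x ⟨x, v⟩).2 := by
    filter_upwards [chart_source_mem_nhds E x] with z hz
    rw [← trivializationAt_snd_eq_mvfderiv hz, extend_eq_symm,
      Trivialization.apply_mk_symm _ (by exact hz)]
  have h1 := mvfderiv_mvfderiv_sub (contMDiffAt_extChartAt (I := 𝓘(ℝ, E)) (n := 2) (x := x))
    (mdifferentiableAt_extend 𝓘(ℝ, E) E v) (mdifferentiableAt_extend 𝓘(ℝ, E) E w)
  rw [(h v).mvfderiv_eq, (h w).mvfderiv_eq, mvfderiv_const, mvfderiv_const] at h1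
  have h2 : mfderiv 𝓘(ℝ, E) 𝓘(ℝ, E) (extChartAt 𝓘(ℝ, E) x) x
    (mlieBracket 𝓘(ℝ, E) (extend E v) (extend E w) x) = 0 := by
    exact h1.symm.trans (sub_self _)
  rw [mfderiv_extChartAt_self] at h2
  exact h2

/-- The tangent trivialization is the differential of the chart, so the coordinates of F_*X are
derivatives of a vector-valued function. This brings the calculus of the previous part to bear on
fields along `F`. -/
theorem trivializationAt_mfderiv_eventuallyEq {F : M → N} {x : M} (hF : CMDiffAt 1 F x)
    (X : Π x : M, TangentSpace 𝓘(ℝ, E) x) :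
    (fun z ↦ (trivializationAt E' (fun y : N ↦ TangentSpace 𝓘(ℝ, E') y) (F x)
      ⟨F z, mfderiv 𝓘(ℝ, E) 𝓘(ℝ, E') F z (X z)⟩).2) =ᶠ[𝓝 x]
      fun z ↦ d% (extChartAt 𝓘(ℝ, E') (F x) ∘ F) z (X z) := by
  have hF' := (contMDiffAt_iff_contMDiffAt_nhds (by simp)).1 hF
  filter_upwards [hF', hF.continuousAt (chart_source_mem_nhds E' (F x))] with z hz hzs
  rw [trivializationAt_snd_eq_mvfderiv hzs]
  have := mfderiv_comp z (mdifferentiableAt_extChartAt (I := 𝓘(ℝ, E')) hzs)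
    (hz.mdifferentiableAt one_ne_zero)
  change _ = mfderiv 𝓘(ℝ, E) 𝓘(ℝ, E') (extChartAt 𝓘(ℝ, E') (F x) ∘ F) z (X z)
  rw [this]
  rfl

theorem contMDiffAt_extChartAt_comp {F : M → N} {x : M} (hF : CMDiffAt 2 F x) :
    CMDiffAt 2 (extChartAt 𝓘(ℝ, E') (F x) ∘ F) x :=
  contMDiffAt_extChartAt.comp x hF

/-- The vector field `F_* X` along `F` is differentiable. -/
theorem mdifferentiableAt_trivializationAt_mfderiv {F : M → N} {x : M} (hF : CMDiffAt 2 F x)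
    {X : Π x : M, TangentSpace 𝓘(ℝ, E) x} (hX : MDiffAt (T% X) x) :
    MDiffAt (fun z ↦ (trivializationAt E' (fun y : N ↦ TangentSpace 𝓘(ℝ, E') y) (F x)
      ⟨F z, mfderiv 𝓘(ℝ, E) 𝓘(ℝ, E') F z (X z)⟩).2) x :=
  (mdifferentiableAt_mvfderiv_apply (contMDiffAt_extChartAt_comp hF) hX).1.congr_of_eventuallyEq
    (trivializationAt_mfderiv_eventuallyEq (hF.of_le one_le_two) X)

variable
  [RiemannianBundle (fun y : N ↦ TangentSpace 𝓘(ℝ, E') y)]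
  [IsContMDiffRiemannianBundle 𝓘(ℝ, E') ∞ E' (fun y : N ↦ TangentSpace 𝓘(ℝ, E') y)]

/-- The connection along `F` is torsion free. -/
theorem pullbackNabla_mfderiv_sub {F : M → N} {x : M} (hF : CMDiffAt 2 F x)
    {X Y : Π x : M, TangentSpace 𝓘(ℝ, E) x} (hX : MDiffAt (T% X) x) (hY : MDiffAt (T% Y) x) :
    pullbackNabla (E := E) (E' := E') F (fun z ↦ mfderiv 𝓘(ℝ, E) 𝓘(ℝ, E') F z (Y z)) x (X x) -
      pullbackNabla (E := E) (E' := E') F (fun z ↦ mfderiv 𝓘(ℝ, E) 𝓘(ℝ, E') F z (X z)) x (Y x) =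
      mfderiv 𝓘(ℝ, E) 𝓘(ℝ, E') F x (mlieBracket 𝓘(ℝ, E) X Y x) := by
  have hF1 : CMDiffAt 1 F x := hF.of_le one_le_two
  have h0 := mvfderiv_mvfderiv_sub (contMDiffAt_extChartAt_comp (E' := E') hF) hX hY
  -- The Christoffel parts of the two covariant derivatives agree: the canonical extensions of F_*X
  -- and F_*Y commute.
  have h1 := leviCivita_torsion
    (mdifferentiableAt_extend 𝓘(ℝ, E') E' (mfderiv 𝓘(ℝ, E) 𝓘(ℝ, E') F x (X x)))
    (mdifferentiableAt_extend 𝓘(ℝ, E') E' (mfderiv 𝓘(ℝ, E) 𝓘(ℝ, E') F x (Y x)))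
  rw [mlieBracket_extend, extend_apply_self, extend_apply_self] at h1
  have h2 := (trivializationAt_mfderiv_eventuallyEq (E' := E') hF1
    (mlieBracket 𝓘(ℝ, E) X Y)).self_of_nhds
  dsimp only at h2
  unfold pullbackNabla
  rw [(trivializationAt_mfderiv_eventuallyEq (E' := E') hF1 X).mvfderiv_eq,
    (trivializationAt_mfderiv_eventuallyEq (E' := E') hF1 Y).mvfderiv_eq, add_sub_add_comm, h1,
    add_zero, ← Trivialization.symmL_apply (R := ℝ), ← Trivialization.symmL_apply (R := ℝ), ← map_sub,
    h0, ← h2,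
    Trivialization.symmL_apply]
  · exact Trivialization.symm_apply_apply_mk _ (mem_baseSet_trivializationAt E' _ _) _
  all_goals exact mem_baseSet_trivializationAt E' _ _

theorem mvfderiv_clm_comp {G G' : Type*} [NormedAddCommGroup G] [NormedSpace ℝ G]
    [NormedAddCommGroup G'] [NormedSpace ℝ G'] (L : G →L[ℝ] G') {f : M → G} {x : M}
    (hf : MDiffAt f x) : MDiffAt (fun z ↦ L (f z)) x ∧ ∀ v : TangentSpace 𝓘(ℝ, E) x,
      d% (fun z ↦ L (f z)) x v = L (d% f x v) := by
  refine ⟨L.mdifferentiableAt.comp x hf, fun v ↦ ?_⟩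
  have := mfderiv_comp x (L.mdifferentiableAt (x := f x)) hf
  rw [L.mfderiv_eq] at this
  change mfderiv 𝓘(ℝ, E) 𝓘(ℝ, G') (L ∘ f) x v = _
  rw [this]
  rfl

/-- The connection along `F` is compatible with the metric. -/
theorem pullbackNabla_metric {F : M → N} {x : M} (hF : MDiffAt F x)
    {s s' : Π x : M, TangentSpace 𝓘(ℝ, E') (F x)}
    (hs : MDiffAt (fun z ↦ (trivializationAt E' (fun y : N ↦ TangentSpace 𝓘(ℝ, E') y) (F x)
      ⟨F z, s z⟩).2) x)
    (hs' : MDiffAt (fun z ↦ (trivializationAt E' (fun y : N ↦ TangentSpace 𝓘(ℝ, E') y) (F x)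
      ⟨F z, s' z⟩).2) x) (v : TangentSpace 𝓘(ℝ, E) x) :
    d% (fun z ↦ ⟪s z, s' z⟫_ℝ) x v =
      ⟪pullbackNabla (E := E) (E' := E') F s x v, s' x⟫_ℝ +
        ⟪s x, pullbackNabla (E := E) (E' := E') F s' x v⟫_ℝ := by
  classical
  set e := trivializationAt E' (fun y : N ↦ TangentSpace 𝓘(ℝ, E') y) (F x)
  have hFx : F x ∈ e.baseSet := mem_baseSet_trivializationAt E' _ _
  set b := Module.finBasis ℝ E'
  set w : Fin (Module.finrank ℝ E') → TangentSpace 𝓘(ℝ, E') (F x) := fun i ↦ e.symm (F x) (b i)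
  -- A frame with constant coordinates in the trivialization. Inner products become bilinear in the
  -- coefficients `c`, with Gram functions `g i j` carrying all dependence on the metric.
  set ε : Fin (Module.finrank ℝ E') → Π y : N, TangentSpace 𝓘(ℝ, E') y :=
    fun i ↦ extend E' (w i)
  have hε (i) {y : N} (hy : y ∈ e.baseSet) : ε i y = e.symmL ℝ y (b i) := by
    simp only [ε, extend_eq_symm, w]
    rw [Trivialization.apply_mk_symm _ hFx, Trivialization.symmL_apply _ hy]
  have hεd (i) : MDiffAt (T% (ε i)) (F x) := mdifferentiableAt_extend 𝓘(ℝ, E') E' (w i)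
  have hsum {y : N} (hy : y ∈ e.baseSet) (a : E') :
      e.symmL ℝ y a = ∑ i, b.repr a i • ε i y := by
    conv_lhs => rw [← b.sum_repr a]
    simp only [map_sum, map_smul, hε _ hy]
  set g : Fin (Module.finrank ℝ E') → Fin (Module.finrank ℝ E') → N → ℝ :=
    fun i j y ↦ ⟪ε i y, ε j y⟫_ℝ
  have hg (i j) : MDiffAt (g i j) (F x) := mdiffAt_inner (hεd i) (hεd j)
  have hsym (s : Π x : M, TangentSpace 𝓘(ℝ, E') (F x)) {z : M} (hz : F z ∈ e.baseSet) :
      s z = e.symmL ℝ (F z) (e ⟨F z, s z⟩).2 := by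
    rw [Trivialization.symmL_apply _ hz]
    exact (Trivialization.symm_apply_apply_mk _ hz _).symm
  set c := fun (s : Π x : M, TangentSpace 𝓘(ℝ, E') (F x)) i z ↦ b.repr (e ⟨F z, s z⟩).2 i
  have hprod {y : N} (hy : y ∈ e.baseSet) (a a' : E') : ⟪e.symmL ℝ y a, e.symmL ℝ y a'⟫_ℝ =
      ∑ i, ∑ j, b.repr a i * b.repr a' j * g i j y := by
    rw [hsum hy, hsum hy, sum_inner]
    refine Finset.sum_congr rfl fun i _ ↦ ?_
    rw [inner_sum]
    refine Finset.sum_congr rfl fun j _ ↦ ?_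
    rw [real_inner_smul_left, real_inner_smul_right]
    ring
  have hcd {s : Π x : M, TangentSpace 𝓘(ℝ, E') (F x)}
      (hs : MDiffAt (fun z ↦ (e ⟨F z, s z⟩).2) x) (i) :
      MDiffAt (c s i) x ∧ ∀ v : TangentSpace 𝓘(ℝ, E) x, d% (c s i) x v =
        b.repr (d% (fun z ↦ (e ⟨F z, s z⟩).2) x v) i :=
    mvfderiv_clm_comp (LinearMap.toContinuousLinearMap (b.coord i)) hs
  have hev : (fun z ↦ ⟪s z, s' z⟫_ℝ) =ᶠ[𝓝 x]
      fun z ↦ ∑ i, ∑ j, c s i z * c s' j z * g i j (F z) := by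
    filter_upwards [hF.continuousAt (e.open_baseSet.mem_nhds hFx)] with z hz
    rw [hsym s hz, hsym s' hz, hprod hz]
  have hT (i j) : MDiffAt (fun z ↦ c s i z * c s' j z * g i j (F z)) x ∧
      d% (fun z ↦ c s i z * c s' j z * g i j (F z)) x v =
        b.repr (d% (fun z ↦ (e ⟨F z, s z⟩).2) x v) i * c s' j x * g i j (F x) +
        c s i x * b.repr (d% (fun z ↦ (e ⟨F z, s' z⟩).2) x v) j * g i j (F x) +
        c s i x * c s' j x * d% (g i j) (F x) (mfderiv 𝓘(ℝ, E) 𝓘(ℝ, E') F x v) := by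
    have h1 := hcd hs i
    have h2 := hcd hs' j
    have h3 : MDiffAt (fun z ↦ g i j (F z)) x := (hg i j).comp x hF
    have h4 : d% (fun z ↦ g i j (F z)) x v =
        d% (g i j) (F x) (mfderiv 𝓘(ℝ, E) 𝓘(ℝ, E') F x v) := mvfderiv_comp_apply x (hg i j) hF v
    have h5 : MDiffAt (fun z ↦ c s i z * c s' j z) x := h1.1.mul h2.1
    refine ⟨h5.mul h3, ?_⟩
    rw [mvfderiv_fun_mul h5 h3, mvfderiv_fun_mul h1.1 h2.1]
    simp only [add_apply, smul_apply, smul_eq_mul, h4, h1.2, h2.2]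
    ring
  have hL : d% (fun z ↦ ⟪s z, s' z⟫_ℝ) x v = ∑ i, ∑ j,
      d% (fun z ↦ c s i z * c s' j z * g i j (F z)) x v := by
    rw [hev.mvfderiv_eq, (mvfderiv_fun_sum _ fun i ↦ (mvfderiv_fun_sum _ fun j ↦ (hT i j).1).1).2]
    simp only [sum_apply]
    refine Finset.sum_congr rfl fun i _ ↦ ?_
    rw [(mvfderiv_fun_sum _ fun j ↦ (hT i j).1).2, sum_apply]
  -- The canonical extensions of `s x` and `s' x` keep the coefficients frozen at `x`. Metric
  -- compatibility on N for these two fields therefore accounts for exactly the terms that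
  -- differentiate the Gram functions.
  have hext : (fun y ↦ ⟪extend E' (s x) y, extend E' (s' x) y⟫_ℝ) =ᶠ[𝓝 (F x)]
      fun y ↦ ∑ i, ∑ j, c s i x * c s' j x * g i j y := by
    filter_upwards [e.open_baseSet.mem_nhds hFx] with y hy
    rw [extend_eq_symm, extend_eq_symm, ← Trivialization.symmL_apply (R := ℝ) _ hy,
      ← Trivialization.symmL_apply (R := ℝ) _ hy]
    exact hprod hy _ _
  have hgc (i j) : MDiffAt (fun y ↦ c s i x * c s' j x * g i j y) (F x) ∧
      ∀ u : TangentSpace 𝓘(ℝ, E') (F x), d% (fun y ↦ c s i x * c s' j x * g i j y) (F x) u =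
        c s i x * c s' j x * d% (g i j) (F x) u := by
    have h0 : MDiffAt (fun _ : N ↦ c s i x * c s' j x) (F x) := mdifferentiableAt_const
    refine ⟨h0.mul (hg i j), fun u ↦ ?_⟩
    rw [mvfderiv_fun_mul h0 (hg i j), mvfderiv_const]
    simp
  have hM := leviCivita_metric (mdifferentiableAt_extend 𝓘(ℝ, E') E'
    (mfderiv 𝓘(ℝ, E) 𝓘(ℝ, E') F x v)) (mdifferentiableAt_extend 𝓘(ℝ, E') E' (s x))
    (mdifferentiableAt_extend 𝓘(ℝ, E') E' (s' x))
  rw [hext.mvfderiv_eq, (mvfderiv_fun_sum _ fun i ↦ (mvfderiv_fun_sum _ fun j ↦ (hgc i j).1).1).2,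
    sum_apply, extend_apply_self, extend_apply_self, extend_apply_self] at hM
  have hM' (i) := congrArg (fun A ↦ A (mfderiv 𝓘(ℝ, E) 𝓘(ℝ, E') F x v))
    (mvfderiv_fun_sum Finset.univ fun j ↦ (hgc i j).1).2
  simp only [sum_apply, (hgc _ _).2] at hM'
  simp only [hM'] at hM
  unfold pullbackNabla
  rw [inner_add_left, inner_add_right, add_add_add_comm, ← hM, hL,
    ← Trivialization.symmL_apply (R := ℝ) _ hFx, ← Trivialization.symmL_apply (R := ℝ) _ hFx]
  conv_rhs => enter [1, 1]; rw [hsym s' hFx]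
  conv_rhs => enter [1, 2]; rw [hsym s hFx]
  rw [hprod hFx, hprod hFx]
  simp only [← Finset.sum_add_distrib]
  exact Finset.sum_congr rfl fun i _ ↦ Finset.sum_congr rfl fun j _ ↦ (hT i j).2

end Pullback

/-! ### Smoothness of orthogonal projections and extension of vectors to sections -/

section Projections

variable {E : Type*} [NormedAddCommGroup E] [NormedSpace ℝ E] [FiniteDimensional ℝ E]
  {M : Type*} [TopologicalSpace M] [ChartedSpace E M] [IsManifold 𝓘(ℝ, E) ∞ M]

theorem IsSmoothFieldOn.add {X Y : Π x : M, TangentSpace 𝓘(ℝ, E) x} {U : Set M}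
    (hX : IsSmoothFieldOn X U) (hY : IsSmoothFieldOn Y U) :
    IsSmoothFieldOn (fun x ↦ X x + Y x) U :=
  ContMDiffOn.add_section hX hY

theorem IsSmoothFieldOn.sub {X Y : Π x : M, TangentSpace 𝓘(ℝ, E) x} {U : Set M}
    (hX : IsSmoothFieldOn X U) (hY : IsSmoothFieldOn Y U) :
    IsSmoothFieldOn (fun x ↦ X x - Y x) U :=
  ContMDiffOn.sub_section hX hY

theorem IsSmoothFieldOn.smul {X : Π x : M, TangentSpace 𝓘(ℝ, E) x} {f : M → ℝ} {U : Set M}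
    (hf : CMDiff[U] ∞ f) (hX : IsSmoothFieldOn X U) : IsSmoothFieldOn (fun x ↦ f x • X x) U :=
  ContMDiffOn.smul_section hf hX

theorem IsSmoothFieldOn.congr {X Y : Π x : M, TangentSpace 𝓘(ℝ, E) x} {U : Set M}
    (hX : IsSmoothFieldOn X U) (h : ∀ x ∈ U, Y x = X x) : IsSmoothFieldOn Y U :=
  ContMDiffOn.congr hX fun x hx ↦ by rw [h x hx]

theorem IsSmoothFieldOn.mono {X : Π x : M, TangentSpace 𝓘(ℝ, E) x} {U W : Set M}
    (hX : IsSmoothFieldOn X U) (h : W ⊆ U) : IsSmoothFieldOn X W :=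
  ContMDiffOn.mono hX h

theorem IsSmoothFieldOn.of_local {X : Π x : M, TangentSpace 𝓘(ℝ, E) x} {U : Set M}
    (h : ∀ p ∈ U, ∃ W, IsOpen W ∧ p ∈ W ∧ IsSmoothFieldOn X W) : IsSmoothFieldOn X U := by
  intro p hp
  obtain ⟨W, hW, hpW, hX⟩ := h p hp
  exact (hX.contMDiffAt (hW.mem_nhds hpW)).contMDiffWithinAt

theorem IsSmoothFieldOn.mdiffAt {X : Π x : M, TangentSpace 𝓘(ℝ, E) x} {U : Set M}
    (hX : IsSmoothFieldOn X U) (hU : IsOpen U) {x : M} (hx : x ∈ U) : MDiffAt (T% X) x :=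
  (hX.contMDiffAt (hU.mem_nhds hx)).mdifferentiableAt (by simp)

theorem IsSmoothFieldOn.apply {J : Π x : M, TangentSpace 𝓘(ℝ, E) x →L[ℝ] TangentSpace 𝓘(ℝ, E) x}
    {X : Π x : M, TangentSpace 𝓘(ℝ, E) x} {U : Set M}
    (hX : IsSmoothFieldOn X U) (hJ : IsSmoothEndOn J U) : IsSmoothFieldOn (fun x ↦ J x (X x)) U :=
  ContMDiffOn.clm_bundle_apply (F₁ := E) (F₂ := E) (E₁ := fun x : M ↦ TangentSpace 𝓘(ℝ, E) x)
    (E₂ := fun x : M ↦ TangentSpace 𝓘(ℝ, E) x) (b := fun x ↦ x) hJ hX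

/-- Every tangent vector is the value of a smooth vector field. -/
theorem exists_isSmoothFieldOn_univ [T2Space M] (p : M) (v : TangentSpace 𝓘(ℝ, E) p) :
    ∃ X : Π x : M, TangentSpace 𝓘(ℝ, E) x, IsSmoothFieldOn X Set.univ ∧ X p = v := by
  obtain ⟨s, hs, hX⟩ := exists_contMDiffOn_extend (k := ∞) 𝓘(ℝ, E) E v
  -- The bump function has its closed support inside the region where the local extension is smooth,
  -- so the product is smooth everywhere.
  obtain ⟨f, hf⟩ := ((SmoothBumpFunction.nhds_basis_tsupport (I := 𝓘(ℝ, E)) p).mem_iff).1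
    (interior_mem_nhds.2 hs)
  refine ⟨fun x ↦ f x • extend E v x, ?_, by simp⟩
  exact (ContMDiffOn.smul_section_of_tsupport (f.contMDiff.contMDiffOn) isOpen_interior hf.2
    (hX.mono interior_subset)).contMDiffOn

variable
  [RiemannianBundle (fun x : M ↦ TangentSpace 𝓘(ℝ, E) x)]
  [IsContMDiffRiemannianBundle 𝓘(ℝ, E) ∞ E (fun x : M ↦ TangentSpace 𝓘(ℝ, E) x)]

theorem IsSmoothFieldOn.inner {X Y : Π x : M, TangentSpace 𝓘(ℝ, E) x} {U : Set M}
    (hX : IsSmoothFieldOn X U) (hY : IsSmoothFieldOn Y U) :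
    CMDiff[U] ∞ (fun x ↦ ⟪X x, Y x⟫_ℝ) :=
  ContMDiffOn.inner_bundle (IB := 𝓘(ℝ, E)) (F := E) (B := M)
    (E := fun x : M ↦ TangentSpace 𝓘(ℝ, E) x) (b := fun y ↦ y) hX hY

/-- In the span of a smooth frame there is a smooth field with prescribed smooth inner products
with the members of the frame. -/
theorem exists_isSmoothFieldOn_inner_eq {W : Set M} {k : ℕ}
    {s : Fin k → Π x : M, TangentSpace 𝓘(ℝ, E) x} (hs : ∀ i, IsSmoothFieldOn (s i) W)
    (hli : ∀ x ∈ W, LinearIndependent ℝ (fun i ↦ s i x)) {c : Fin k → M → ℝ}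
    (hc : ∀ i, CMDiff[W] ∞ (c i)) :
    ∃ Z : Π x : M, TangentSpace 𝓘(ℝ, E) x, IsSmoothFieldOn Z W ∧ ∀ x ∈ W,
      Z x ∈ Submodule.span ℝ (Set.range fun i ↦ s i x) ∧ ∀ i, ⟪Z x, s i x⟫_ℝ = c i x := by
  induction k with
  | zero =>
    refine ⟨fun _ ↦ 0, ?_, fun x _ ↦ ⟨zero_mem _, fun i ↦ i.elim0⟩⟩
    exact (contMDiff_zeroSection ℝ (fun x : M ↦ TangentSpace 𝓘(ℝ, E) x)).contMDiffOn
  | succ k ih =>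
    have hli' (x) (hx : x ∈ W) := linearIndependent_finSucc'.1 (hli x hx)
    -- A Gram–Schmidt step: `P` is the projection of the last frame field onto the span of the
    -- others, and `u`, the difference, is nowhere zero and orthogonal to them.
    obtain ⟨P, hP, hP'⟩ := ih (s := fun i ↦ s i.castSucc) (fun i ↦ hs _)
      (fun x hx ↦ (hli' x hx).1) (c := fun i x ↦ ⟪s (Fin.last k) x, s i.castSucc x⟫_ℝ)
      (fun i ↦ (hs _).inner (hs _))
    obtain ⟨Z, hZ, hZ'⟩ := ih (s := fun i ↦ s i.castSucc) (fun i ↦ hs _)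
      (fun x hx ↦ (hli' x hx).1) (c := fun i ↦ c i.castSucc) (fun i ↦ hc _)
    set u : Π x : M, TangentSpace 𝓘(ℝ, E) x := fun x ↦ s (Fin.last k) x - P x with hu
    have hus : IsSmoothFieldOn u W := (hs _).sub hP
    have hu0 (x) (hx : x ∈ W) : ⟪u x, u x⟫_ℝ ≠ 0 := by
      rw [inner_self_ne_zero]
      intro h
      exact (hli' x hx).2 (sub_eq_zero.1 h ▸ (hP' x hx).1)
    have hui (x) (hx : x ∈ W) (i : Fin k) : ⟪u x, s i.castSucc x⟫_ℝ = 0 := by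
      rw [hu, inner_sub_left, (hP' x hx).2, sub_self]
    have huspan (x) (hx : x ∈ W) (y : TangentSpace 𝓘(ℝ, E) x)
        (hy : y ∈ Submodule.span ℝ (Set.range fun i : Fin k ↦ s i.castSucc x)) :
        ⟪u x, y⟫_ℝ = 0 := by
      have h1 : Submodule.span ℝ (Set.range fun i : Fin k ↦ s i.castSucc x) ≤
          (ℝ ∙ u x)ᗮ := by
        rw [Submodule.span_le]
        rintro _ ⟨i, rfl⟩
        exact Submodule.mem_orthogonal_singleton_iff_inner_right.2 (hui x hx i)
      exact Submodule.mem_orthogonal_singleton_iff_inner_right.1 (h1 hy)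
    have hmono (x) : Submodule.span ℝ (Set.range fun i : Fin k ↦ s i.castSucc x) ≤
        Submodule.span ℝ (Set.range fun i ↦ s i x) := by
      refine Submodule.span_mono ?_
      rintro _ ⟨i, rfl⟩
      exact ⟨i.castSucc, rfl⟩
    -- `Z` already has the right products with the first `k` fields. A multiple of `u` leaves these
    -- alone, and its coefficient corrects the product with the last one.
    refine ⟨fun x ↦ Z x +
      ((c (Fin.last k) x - ⟪Z x, s (Fin.last k) x⟫_ℝ) / ⟪u x, u x⟫_ℝ) • u x, ?_, fun x hx ↦ ⟨?_, ?_⟩⟩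
    · exact hZ.add (.smul (((hc _).sub (hZ.inner (hs _))).div₀ (hus.inner hus) hu0) hus)
    · refine add_mem (hmono x (hZ' x hx).1) (Submodule.smul_mem _ _ (sub_mem ?_ ?_))
      · exact Submodule.subset_span ⟨_, rfl⟩
      · exact hmono x (hP' x hx).1
    · intro i
      refine Fin.lastCases ?_ (fun i ↦ ?_) i
      · have h1 : ⟪u x, s (Fin.last k) x⟫_ℝ = ⟪u x, u x⟫_ℝ := by
          have h2 := huspan x hx _ (hP' x hx).1
          have h3 : s (Fin.last k) x = u x + P x := by simp [hu]
          rw [h3, inner_add_right, h2, add_zero]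
        rw [inner_add_left, real_inner_smul_left, h1, div_mul_cancel₀ _ (hu0 x hx)]
        ring
      · rw [inner_add_left, real_inner_smul_left, hui x hx, (hZ' x hx).2]
        ring

/-- The orthogonal projection of a smooth field onto a distribution is smooth. -/
theorem IsDistributionOn.starProjection {D : Π x : M, Submodule ℝ (TangentSpace 𝓘(ℝ, E) x)}
    {U : Set M} (hD : IsDistributionOn D U) {X : Π x : M, TangentSpace 𝓘(ℝ, E) x}
    (hX : IsSmoothFieldOn X U) : IsSmoothFieldOn (fun x ↦ (D x).starProjection (X x)) U := by
  refine .of_local fun p hp ↦ ?_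
  obtain ⟨W, k, s, hW, hpW, hWU, hs, hsp⟩ := hD p hp
  refine ⟨W, hW, hpW, ?_⟩
  -- An element of `D x` with the same products as `X x` with a frame of `D x` is its projection.
  obtain ⟨Z, hZ, hZ'⟩ := exists_isSmoothFieldOn_inner_eq hs (fun x hx ↦ (hsp x hx).1)
    (c := fun i x ↦ ⟪X x, s i x⟫_ℝ) (fun i ↦ (hX.mono hWU).inner (hs i))
  refine hZ.congr fun x hx ↦ ?_
  obtain ⟨h1, h2⟩ := hZ' x hx
  refine Submodule.eq_starProjection_of_mem_of_inner_eq_zero ((hsp x hx).2 ▸ h1) fun w hw ↦ ?_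
  have h3 : D x ≤ (ℝ ∙ (X x - Z x))ᗮ := by
    rw [← (hsp x hx).2, Submodule.span_le]
    rintro _ ⟨i, rfl⟩
    refine Submodule.mem_orthogonal_singleton_iff_inner_right.2 ?_
    rw [inner_sub_left, h2, sub_self]
  exact Submodule.mem_orthogonal_singleton_iff_inner_right.1 (h3 hw)

variable {E' : Type*} [NormedAddCommGroup E'] [NormedSpace ℝ E'] [FiniteDimensional ℝ E']
  {N : Type*} [TopologicalSpace N] [ChartedSpace E' N] [IsManifold 𝓘(ℝ, E') ∞ N]

/-- The Riesz representative of a smooth 1-form is smooth: prescribe its products with a coordinate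
frame. Such a frame exists because `W` lies in a chart domain. -/
theorem exists_isSmoothFieldOn_gradient (p : M) {W : Set M}
    (hWp : W ⊆ (chartAt E p).source)
    {θ : Π x : M, TangentSpace 𝓘(ℝ, E) x →ₗ[ℝ] ℝ}
    (hθ : ∀ X : Π x : M, TangentSpace 𝓘(ℝ, E) x, IsSmoothFieldOn X W →
      CMDiff[W] ∞ (fun x ↦ θ x (X x))) :
    ∃ Z : Π x : M, TangentSpace 𝓘(ℝ, E) x, IsSmoothFieldOn Z W ∧ ∀ x ∈ W, ∀ v,
      ⟪Z x, v⟫_ℝ = θ x v := by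
  set e := trivializationAt E (fun x : M ↦ TangentSpace 𝓘(ℝ, E) x) p
  have he := (e.isLocalFrameOn_localFrame_baseSet 𝓘(ℝ, E) ∞ (Module.finBasis ℝ E)).mono hWp
  obtain ⟨Z, hZ, hZ'⟩ := exists_isSmoothFieldOn_inner_eq (fun i ↦ he.contMDiffOn i)
    (fun x hx ↦ he.linearIndependent hx) (c := fun i x ↦ θ x (e.localFrame (Module.finBasis ℝ E) i x))
    (fun i ↦ hθ _ (he.contMDiffOn i))
  refine ⟨Z, hZ, fun x hx v ↦ ?_⟩
  have h : ((innerSL ℝ (Z x)).toLinearMap) = θ x :=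
    (he.toBasisAt hx).ext fun i ↦ by simpa using (hZ' x hx).2 i
  rw [← h]
  rfl

/-- The coordinates of F_* in a local trivialization are 1-forms with common kernel ker F_*. Their
Riesz representatives span the orthogonal complement, and surjectivity of F_* makes them
independent. -/
theorem isDistributionOn_horizontal {F : M → N} (hF : ContMDiff 𝓘(ℝ, E) 𝓘(ℝ, E') ∞ F)
    (hsub : ∀ x, Function.Surjective (mfderiv 𝓘(ℝ, E) 𝓘(ℝ, E') F x)) :
    IsDistributionOn (horizontal (E := E) (E' := E') F) Set.univ := by
  intro p _
  set t := trivializationAt E' (fun y : N ↦ TangentSpace 𝓘(ℝ, E') y) (F p)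
  set b := Module.finBasis ℝ E'
  have hp : F p ∈ t.baseSet := mem_baseSet_trivializationAt E' _ _
  set W : Set M := (chartAt E p).source ∩ F ⁻¹' t.baseSet
  have hW : IsOpen W := (chartAt E p).open_source.inter (t.open_baseSet.preimage hF.continuous)
  set θ : Fin (Module.finrank ℝ E') → Π x : M, TangentSpace 𝓘(ℝ, E) x →ₗ[ℝ] ℝ := fun a x ↦
    b.coord a ∘ₗ (t.continuousLinearMapAt ℝ (F x)).toLinearMap ∘ₗ
      (mfderiv 𝓘(ℝ, E) 𝓘(ℝ, E') F x).toLinearMap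
  have hθ (a) (X : Π x : M, TangentSpace 𝓘(ℝ, E) x) (hX : IsSmoothFieldOn X W) :
      CMDiff[W] ∞ (fun x ↦ θ a x (X x)) := by
    have h1 : CMDiff[W] ∞ (fun x ↦ tangentMap 𝓘(ℝ, E) 𝓘(ℝ, E') F (T% X x)) :=
      (hF.contMDiff_tangentMap (m := ∞) (by simp)).comp_contMDiffOn hX
    have h2 : CMDiff[W] ∞ (fun x ↦ (t (tangentMap 𝓘(ℝ, E) 𝓘(ℝ, E') F (T% X x))).2) := by
      have h3 : ContMDiffOn (𝓘(ℝ, E').prod 𝓘(ℝ, E')) (𝓘(ℝ, E').prod 𝓘(ℝ, E')) ∞ t t.source :=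
        t.contMDiffOn
      exact contMDiff_snd.comp_contMDiffOn (h3.comp h1 fun x hx ↦ t.mem_source.2 hx.2)
    have h4 : CMDiff[W] ∞ (fun x ↦ (LinearMap.toContinuousLinearMap (b.coord a))
        (t (tangentMap 𝓘(ℝ, E) 𝓘(ℝ, E') F (T% X x))).2) :=
      (LinearMap.toContinuousLinearMap (b.coord a)).contMDiff.comp_contMDiffOn h2
    refine h4.congr fun x hx ↦ ?_
    simp only [θ, LinearMap.comp_apply, ContinuousLinearMap.coe_coe]
    rw [Trivialization.continuousLinearMapAt_apply, Trivialization.linearMapAt_apply,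
      if_pos (show F x ∈ t.baseSet from hx.2)]
    rfl
  choose Z hZ hZ' using fun a ↦ exists_isSmoothFieldOn_gradient p Set.inter_subset_left (hθ a)
  have hsurj (x) (hx : x ∈ W) (w : E') : ∃ v : TangentSpace 𝓘(ℝ, E) x,
      ∀ a, ⟪Z a x, v⟫_ℝ = b.repr w a := by
    obtain ⟨v, hv⟩ := hsub x (t.symmL ℝ (F x) w)
    refine ⟨v, fun a ↦ ?_⟩
    rw [hZ' a x hx]
    simp only [θ, LinearMap.comp_apply, ContinuousLinearMap.coe_coe, hv]
    rw [Trivialization.continuousLinearMapAt_symmL _ hx.2]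
    rfl
  refine ⟨W, _, Z, hW, ⟨mem_chart_source E p, hp⟩,
    Set.subset_univ _, hZ, fun x hx ↦ ⟨?_, ?_⟩⟩
  · rw [Fintype.linearIndependent_iff]
    intro r hr j
    obtain ⟨v, hv⟩ := hsurj x hx (b j)
    have h1 : ⟪∑ i, r i • Z i x, v⟫_ℝ = 0 := by rw [hr, inner_zero_left]
    simp only [sum_inner, real_inner_smul_left, hv, Module.Basis.repr_self,
      Finsupp.single_apply] at h1
    simpa using h1
  · have h1 : vertical (E := E) (E' := E') F x =
        (Submodule.span ℝ (Set.range fun i ↦ Z i x))ᗮ := by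
      ext v
      have h2 : v ∈ (Submodule.span ℝ (Set.range fun i ↦ Z i x))ᗮ ↔ ∀ a, ⟪Z a x, v⟫_ℝ = 0 := by
        refine ⟨fun h a ↦ h _ (Submodule.subset_span ⟨a, rfl⟩), fun h w hw ↦ ?_⟩
        have h3 : Submodule.span ℝ (Set.range fun i ↦ Z i x) ≤ (ℝ ∙ v)ᗮ := by
          rw [Submodule.span_le]
          rintro _ ⟨i, rfl⟩
          exact Submodule.mem_orthogonal_singleton_iff_inner_left.2 (h i)
        exact Submodule.mem_orthogonal_singleton_iff_inner_left.1 (h3 hw)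
      rw [h2]
      refine ⟨fun h a ↦ ?_, fun h ↦ ?_⟩
      · rw [hZ' a x hx]
        have h3 : mfderiv 𝓘(ℝ, E) 𝓘(ℝ, E') F x v = 0 := h
        simp only [θ, LinearMap.comp_apply, ContinuousLinearMap.coe_coe, h3, map_zero]
      · have h3 : t.continuousLinearMapAt ℝ (F x) (mfderiv 𝓘(ℝ, E) 𝓘(ℝ, E') F x v) = 0 := by
          refine b.ext_elem fun a ↦ ?_
          rw [map_zero, Finsupp.zero_apply, ← h a, hZ' a x hx]
          rfl
        have h4 := Trivialization.symmL_continuousLinearMapAt (R := ℝ) t hx.2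
          (mfderiv 𝓘(ℝ, E) 𝓘(ℝ, E') F x v)
        rw [h3, map_zero] at h4
        exact h4.symm
    rw [horizontal, h1, Submodule.orthogonal_orthogonal]

theorem IsSmoothFieldOn.hProj {F : M → N} (hF : ContMDiff 𝓘(ℝ, E) 𝓘(ℝ, E') ∞ F)
    (hsub : ∀ x, Function.Surjective (mfderiv 𝓘(ℝ, E) 𝓘(ℝ, E') F x))
    {X : Π x : M, TangentSpace 𝓘(ℝ, E) x} {U : Set M} (hU : IsOpen U) (hX : IsSmoothFieldOn X U) :
    IsSmoothFieldOn (fun x ↦ _root_.hProj (E' := E') F x (X x)) U := by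
  refine IsDistributionOn.starProjection (D := horizontal (E := E) (E' := E') F) ?_ hX
  intro p hp
  obtain ⟨W, k, s, hW, hpW, -, hs, hsp⟩ := isDistributionOn_horizontal hF hsub p (Set.mem_univ p)
  exact ⟨W ∩ U, k, s, hW.inter hU, ⟨hpW, hp⟩, Set.inter_subset_right,
    fun i ↦ (hs i).mono Set.inter_subset_left, fun x hx ↦ hsp x hx.1⟩

theorem hProj_eq_sub (F : M → N) (x : M) (v : TangentSpace 𝓘(ℝ, E) x) :
    hProj (E' := E') F x v = v - vProj (E' := E') F x v :=
  Submodule.starProjection_orthogonal_val v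

theorem vProj_add_hProj (F : M → N) (x : M) (v : TangentSpace 𝓘(ℝ, E) x) :
    vProj (E' := E') F x v + hProj (E' := E') F x v = v := by
  rw [hProj_eq_sub, add_sub_cancel]

theorem IsSmoothFieldOn.vProj {F : M → N} (hF : ContMDiff 𝓘(ℝ, E) 𝓘(ℝ, E') ∞ F)
    (hsub : ∀ x, Function.Surjective (mfderiv 𝓘(ℝ, E) 𝓘(ℝ, E') F x))
    {X : Π x : M, TangentSpace 𝓘(ℝ, E) x} {U : Set M} (hU : IsOpen U) (hX : IsSmoothFieldOn X U) :
    IsSmoothFieldOn (fun x ↦ _root_.vProj (E' := E') F x (X x)) U :=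
  (hX.sub (hX.hProj hF hsub hU)).congr fun x _ ↦ by rw [hProj_eq_sub, sub_sub_cancel]

theorem exists_isSectionOn_horizontal [T2Space M] {F : M → N}
    (hF : ContMDiff 𝓘(ℝ, E) 𝓘(ℝ, E') ∞ F)
    (hsub : ∀ x, Function.Surjective (mfderiv 𝓘(ℝ, E) 𝓘(ℝ, E') F x)) {U : Set M} (hU : IsOpen U)
    {p : M} {v : TangentSpace 𝓘(ℝ, E) p} (hv : v ∈ horizontal (E := E) (E' := E') F p) :
    ∃ X, IsSectionOn (horizontal (E := E) (E' := E') F) X U ∧ X p = v := by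
  obtain ⟨X, hX, rfl⟩ := exists_isSmoothFieldOn_univ p v
  exact ⟨_, ⟨(hX.mono (Set.subset_univ U)).hProj hF hsub hU,
    fun x _ ↦ Submodule.starProjection_apply_mem _ _⟩, Submodule.starProjection_eq_self_iff.2 hv⟩

theorem exists_isSectionOn_distTwo [T2Space M] {F : M → N}
    (hF : ContMDiff 𝓘(ℝ, E) 𝓘(ℝ, E') ∞ F)
    (hsub : ∀ x, Function.Surjective (mfderiv 𝓘(ℝ, E) 𝓘(ℝ, E') F x)) {U : Set M} (hU : IsOpen U)
    {D₁ : Π x : M, Submodule ℝ (TangentSpace 𝓘(ℝ, E) x)} (hD : IsDistributionOn D₁ U)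
    (hle : ∀ x ∈ U, D₁ x ≤ vertical (E := E) (E' := E') F x)
    {p : M} {v : TangentSpace 𝓘(ℝ, E) p} (hv : v ∈ distTwo (E' := E') F D₁ p) :
    ∃ V, IsSectionOn (distTwo (E' := E') F D₁) V U ∧ V p = v := by
  obtain ⟨X, hX, rfl⟩ := exists_isSmoothFieldOn_univ p v
  replace hX := hX.mono (Set.subset_univ U)
  -- Since 𝒟₁ lies in ker F_*, the difference of the two projections is the projection onto 𝒟₂.
  refine ⟨fun x ↦ _root_.vProj (E' := E') F x (X x) - (D₁ x).starProjection (X x),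
    ⟨(hX.vProj hF hsub hU).sub (hD.starProjection hX), fun x hx ↦ ⟨?_, fun d hd ↦ ?_⟩⟩, ?_⟩
  · exact sub_mem (Submodule.starProjection_apply_mem _ _)
      (hle x hx (Submodule.starProjection_apply_mem _ _))
  · have h1 := Submodule.starProjection_inner_eq_zero (K := D₁ x) (X x) d hd
    have h2 := Submodule.starProjection_inner_eq_zero (K := vertical (E := E) (E' := E') F x)
      (X x) d (hle x hx hd)
    rw [real_inner_comm]
    simp only [_root_.vProj]
    rw [inner_sub_left] at h1 h2 ⊢
    linarith
  · have h1 : _root_.vProj (E' := E') F p (X p) = X p := Submodule.starProjection_eq_self_iff.2 hv.1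
    have h2 : (D₁ p).starProjection (X p) = 0 :=
      (Submodule.starProjection_apply_eq_zero_iff _).2 hv.2
    beta_reduce
    rw [h1, h2, sub_zero]

end Projections

/-! ### Horizontally conformal submersions -/

section Conformal

variable {E : Type*} [NormedAddCommGroup E] [NormedSpace ℝ E] [FiniteDimensional ℝ E]
  {M : Type*} [TopologicalSpace M] [ChartedSpace E M] [IsManifold 𝓘(ℝ, E) ∞ M]
  [RiemannianBundle (fun x : M ↦ TangentSpace 𝓘(ℝ, E) x)]
  [IsContMDiffRiemannianBundle 𝓘(ℝ, E) ∞ E (fun x : M ↦ TangentSpace 𝓘(ℝ, E) x)]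
  {E' : Type*} [NormedAddCommGroup E'] [NormedSpace ℝ E'] [FiniteDimensional ℝ E']
  {N : Type*} [TopologicalSpace N] [ChartedSpace E' N] [IsManifold 𝓘(ℝ, E') ∞ N]
  [RiemannianBundle (fun y : N ↦ TangentSpace 𝓘(ℝ, E') y)]
  [IsContMDiffRiemannianBundle 𝓘(ℝ, E') ∞ E' (fun y : N ↦ TangentSpace 𝓘(ℝ, E') y)]
  {F : M → N} {lam : M → ℝ}

theorem mfderiv_hProj (F : M → N) (x : M) (v : TangentSpace 𝓘(ℝ, E) x) :
    mfderiv 𝓘(ℝ, E) 𝓘(ℝ, E') F x (hProj (E' := E') F x v) = mfderiv 𝓘(ℝ, E) 𝓘(ℝ, E') F x v := by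
  have h : mfderiv 𝓘(ℝ, E) 𝓘(ℝ, E') F x (vProj (E' := E') F x v) = 0 :=
    Submodule.starProjection_apply_mem (vertical (E := E) (E' := E') F x) v
  rw [hProj_eq_sub, map_sub, h, sub_zero]

theorem hProj_mem (F : M → N) (x : M) (v : TangentSpace 𝓘(ℝ, E) x) :
    hProj (E' := E') F x v ∈ horizontal (E := E) (E' := E') F x :=
  Submodule.starProjection_apply_mem _ _

theorem vProj_mem (F : M → N) (x : M) (v : TangentSpace 𝓘(ℝ, E) x) :
    vProj (E' := E') F x v ∈ vertical (E := E) (E' := E') F x :=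
  Submodule.starProjection_apply_mem _ _

theorem inner_eq_zero_of_vertical_of_horizontal {x : M} {v w : TangentSpace 𝓘(ℝ, E) x}
    (hv : v ∈ vertical (E := E) (E' := E') F x) (hw : w ∈ horizontal (E := E) (E' := E') F x) :
    ⟪v, w⟫_ℝ = 0 := hw v hv

theorem inner_hProj {x : M} (v : TangentSpace 𝓘(ℝ, E) x) {w : TangentSpace 𝓘(ℝ, E) x}
    (hw : w ∈ horizontal (E := E) (E' := E') F x) :
    ⟪hProj (E' := E') F x v, w⟫_ℝ = ⟪v, w⟫_ℝ := by
  rw [hProj_eq_sub, inner_sub_left,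
    inner_eq_zero_of_vertical_of_horizontal (vProj_mem F x v) hw, sub_zero]

theorem hProj_of_mem {x : M} {w : TangentSpace 𝓘(ℝ, E) x}
    (hw : w ∈ horizontal (E := E) (E' := E') F x) : hProj (E' := E') F x w = w :=
  Submodule.starProjection_eq_self_iff.2 hw

theorem vProj_of_mem {x : M} {w : TangentSpace 𝓘(ℝ, E) x}
    (hw : w ∈ vertical (E := E) (E' := E') F x) : vProj (E' := E') F x w = w :=
  Submodule.starProjection_eq_self_iff.2 hw

/-- One horizontal argument suffices, because F_* kills the vertical part of the other. This matters
for brackets and covariant derivatives, which need not be horizontal. -/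
theorem IsHConformalSubmersion.inner_mfderiv_of_right
    (h : IsHConformalSubmersion (E := E) (E' := E') F lam) {x : M} (v : TangentSpace 𝓘(ℝ, E) x)
    {w : TangentSpace 𝓘(ℝ, E) x} (hw : w ∈ horizontal (E := E) (E' := E') F x) :
    ⟪mfderiv 𝓘(ℝ, E) 𝓘(ℝ, E') F x v, mfderiv 𝓘(ℝ, E) 𝓘(ℝ, E') F x w⟫_ℝ = lam x ^ 2 * ⟪v, w⟫_ℝ := by
  rw [← mfderiv_hProj, h.conformal x _ (hProj_mem F x v) _ hw, inner_hProj _ hw]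

/-- The connection along a horizontally conformal submersion, on basic arguments. -/
theorem IsHConformalSubmersion.inner_pullbackNabla
    (h : IsHConformalSubmersion (E := E) (E' := E') F lam) {U : Set M} (hU : IsOpen U)
    {X Y Z : Π x : M, TangentSpace 𝓘(ℝ, E) x}
    (hX : IsSectionOn (horizontal (E := E) (E' := E') F) X U)
    (hY : IsSectionOn (horizontal (E := E) (E' := E') F) Y U)
    (hZ : IsSectionOn (horizontal (E := E) (E' := E') F) Z U) {x : M} (hx : x ∈ U) :
    ⟪pullbackNabla (E := E) (E' := E') F (fun y ↦ mfderiv 𝓘(ℝ, E) 𝓘(ℝ, E') F y (Y y)) x (X x),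
      mfderiv 𝓘(ℝ, E) 𝓘(ℝ, E') F x (Z x)⟫_ℝ =
      lam x ^ 2 * ⟪leviCivita E M Y x (X x), Z x⟫_ℝ + lam x * (d% lam x (X x) * ⟪Y x, Z x⟫_ℝ +
        d% lam x (Y x) * ⟪X x, Z x⟫_ℝ - d% lam x (Z x) * ⟪X x, Y x⟫_ℝ) := by
  have hF : CMDiffAt 2 F x := (h.contMDiff x).of_le (WithTop.coe_le_coe.2 (le_top : (2 : ℕ∞) ≤ ⊤))
  have hF1 : MDiffAt F x := hF.mdifferentiableAt (by simp)
  have hl : MDiffAt lam x := (h.lam_contMDiff x).mdifferentiableAt (by simp)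
  -- Differentiate g_N(F_*B, F_*C) = λ² g(B, C) along A, using metric compatibility on both sides.
  have key {A B C : Π x : M, TangentSpace 𝓘(ℝ, E) x}
      (hA : IsSectionOn (horizontal (E := E) (E' := E') F) A U)
      (hB : IsSectionOn (horizontal (E := E) (E' := E') F) B U)
      (hC : IsSectionOn (horizontal (E := E) (E' := E') F) C U) :
      ⟪pullbackNabla (E := E) (E' := E') F (fun y ↦ mfderiv 𝓘(ℝ, E) 𝓘(ℝ, E') F y (B y)) x (A x),
        mfderiv 𝓘(ℝ, E) 𝓘(ℝ, E') F x (C x)⟫_ℝ +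
      ⟪pullbackNabla (E := E) (E' := E') F (fun y ↦ mfderiv 𝓘(ℝ, E) 𝓘(ℝ, E') F y (C y)) x (A x),
        mfderiv 𝓘(ℝ, E) 𝓘(ℝ, E') F x (B x)⟫_ℝ =
      lam x ^ 2 * (⟪leviCivita E M B x (A x), C x⟫_ℝ + ⟪leviCivita E M C x (A x), B x⟫_ℝ) +
        2 * lam x * d% lam x (A x) * ⟪B x, C x⟫_ℝ := by
    have hA' := hA.1.mdiffAt hU hx
    have hB' := hB.1.mdiffAt hU hx
    have hC' := hC.1.mdiffAt hU hx
    have h1 := pullbackNabla_metric hF1 (mdifferentiableAt_trivializationAt_mfderiv (E' := E') hF hB')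
      (mdifferentiableAt_trivializationAt_mfderiv (E' := E') hF hC') (A x)
    have h2 : (fun z ↦ ⟪mfderiv 𝓘(ℝ, E) 𝓘(ℝ, E') F z (B z), mfderiv 𝓘(ℝ, E) 𝓘(ℝ, E') F z (C z)⟫_ℝ)
        =ᶠ[𝓝 x] fun z ↦ lam z ^ 2 * ⟪B z, C z⟫_ℝ := by
      filter_upwards [hU.mem_nhds hx] with z hz
      exact h.conformal z _ (hB.2 z hz) _ (hC.2 z hz)
    have h3 := mdiffAt_inner hB' hC'
    have h4 : MDiffAt (fun z ↦ lam z * lam z) x := hl.mul hl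
    simp only [pow_two] at h2
    rw [h2.mvfderiv_eq, mvfderiv_fun_mul h4 h3, mvfderiv_fun_mul hl hl, real_inner_comm _
      (mfderiv 𝓘(ℝ, E) 𝓘(ℝ, E') F x (B x))] at h1
    have h5 := leviCivita_metric hA' hB' hC'
    rw [real_inner_comm _ (B x)] at h5
    simp only [add_apply, smul_apply, smul_eq_mul, h5] at h1
    linear_combination -h1
  have tors {A B C : Π x : M, TangentSpace 𝓘(ℝ, E) x}
      (hA : IsSectionOn (horizontal (E := E) (E' := E') F) A U)
      (hB : IsSectionOn (horizontal (E := E) (E' := E') F) B U)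
      (hC : IsSectionOn (horizontal (E := E) (E' := E') F) C U) :
      ⟪pullbackNabla (E := E) (E' := E') F (fun y ↦ mfderiv 𝓘(ℝ, E) 𝓘(ℝ, E') F y (B y)) x (A x),
        mfderiv 𝓘(ℝ, E) 𝓘(ℝ, E') F x (C x)⟫_ℝ -
      ⟪pullbackNabla (E := E) (E' := E') F (fun y ↦ mfderiv 𝓘(ℝ, E) 𝓘(ℝ, E') F y (A y)) x (B x),
        mfderiv 𝓘(ℝ, E) 𝓘(ℝ, E') F x (C x)⟫_ℝ =
      lam x ^ 2 * (⟪leviCivita E M B x (A x), C x⟫_ℝ - ⟪leviCivita E M A x (B x), C x⟫_ℝ) := by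
    have hA' := hA.1.mdiffAt hU hx
    have hB' := hB.1.mdiffAt hU hx
    rw [← inner_sub_left, ← inner_sub_left, pullbackNabla_mfderiv_sub hF hA' hB',
      leviCivita_torsion hA' hB', h.inner_mfderiv_of_right _ (hC.2 x hx)]
  have k1 := key hX hY hZ
  have k2 := key hY hX hZ
  have k3 := key hZ hX hY
  have t1 := tors hX hY hZ
  have t2 := tors hX hZ hY
  have t3 := tors hY hZ hX
  -- The Koszul combination: metric identities for the three cyclic choices, with torsion identities
  -- exchanging the arguments.
  linear_combination (1/2) * (k1 + k2 - k3 + t1 - t2 - t3)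

/-! ### The defect of the identity (I_α) and its vanishing -/

variable {Q : Π x : M, Submodule ℝ (TangentSpace 𝓘(ℝ, E) x →L[ℝ] TangentSpace 𝓘(ℝ, E) x)}
  {J : Fin 3 → Π x : M, TangentSpace 𝓘(ℝ, E) x →L[ℝ] TangentSpace 𝓘(ℝ, E) x}
  {D₁ : Fin 3 → Π x : M, Submodule ℝ (TangentSpace 𝓘(ℝ, E) x)}
  {om : Fin 3 → Π x : M, TangentSpace 𝓘(ℝ, E) x →L[ℝ] ℝ} {U : Set M}

theorem IsQuaternionicHermitianBasis.inner_left (hJ : IsQuaternionicHermitianBasis Q J U)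
    (α : Fin 3) {x : M} (hx : x ∈ U) (v w : TangentSpace 𝓘(ℝ, E) x) :
    ⟪J α x v, w⟫_ℝ = -⟪v, J α x w⟫_ℝ := by
  rw [← hJ.isometry α x hx, hJ.sq α x hx, inner_neg_left]

/-- The two sides of the identity attached to `J_α` differ by a term in `dlam`. -/
theorem IsHConformalSubmersion.homotheticIdentity_defect
    (h : IsHConformalSubmersion (E := E) (E' := E') F lam) (hU : IsOpen U)
    (hJ : IsAlmostSemiInvariantBasis (E' := E') Q F J D₁ U)
    (hom : IsQuaternionicConnectionForms J om U)
    (hint : IsIntegrableOn (horizontal (E := E) (E' := E') F) U) (α : Fin 3)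
    {X Y V : Π x : M, TangentSpace 𝓘(ℝ, E) x}
    (hX : IsSectionOn (horizontal (E := E) (E' := E') F) X U)
    (hY : IsSectionOn (horizontal (E := E) (E' := E') F) Y U)
    (hV : IsSectionOn (distTwo (E' := E') F (D₁ α)) V U) {x : M} (hx : x ∈ U) :
    (lam x ^ 2)⁻¹ *
          ⟪pullbackNabla (E := E) (E' := E') F
              (fun y ↦ mfderiv 𝓘(ℝ, E) 𝓘(ℝ, E') F y (compC (E' := E') F (J α) X y)) x (Y x)
            - pullbackNabla (E := E) (E' := E') F
              (fun y ↦ mfderiv 𝓘(ℝ, E) 𝓘(ℝ, E') F y (compC (E' := E') F (J α) Y y)) x (X x),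
            mfderiv 𝓘(ℝ, E) 𝓘(ℝ, E') F x (J α x (V x))⟫_ℝ =
        ⟪oneillA (E' := E') F X (compB (E' := E') F (J α) Y) x
            - oneillA (E' := E') F Y (compB (E' := E') F (J α) X) x, J α x (V x)⟫_ℝ
          + om (α + 2) x (Y x) * ⟪compC (E' := E') F (J (α + 1)) X x, J α x (V x)⟫_ℝ
          - om (α + 1) x (Y x) * ⟪compC (E' := E') F (J (α + 2)) X x, J α x (V x)⟫_ℝ
          - om (α + 2) x (X x) * ⟪compC (E' := E') F (J (α + 1)) Y x, J α x (V x)⟫_ℝ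
          + om (α + 1) x (X x) * ⟪compC (E' := E') F (J (α + 2)) Y x, J α x (V x)⟫_ℝ
          + (lam x)⁻¹ * (d% lam x (compC (E' := E') F (J α) X x) * ⟪Y x, J α x (V x)⟫_ℝ
            - d% lam x (compC (E' := E') F (J α) Y x) * ⟪X x, J α x (V x)⟫_ℝ
            - 2 * (d% lam x (J α x (V x)) * ⟪Y x, J α x (X x)⟫_ℝ)) := by
  have hJX {X : Π x : M, TangentSpace 𝓘(ℝ, E) x} (hX : IsSmoothFieldOn X U) :
      IsSmoothFieldOn (fun y ↦ J α y (X y)) U := hX.apply (hJ.basis.smooth α)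
  have hCs {X : Π x : M, TangentSpace 𝓘(ℝ, E) x} (hX : IsSmoothFieldOn X U) :
      IsSectionOn (horizontal (E := E) (E' := E') F) (compC (E' := E') F (J α) X) U :=
    ⟨(hJX hX).hProj h.contMDiff h.submersion hU, fun y _ ↦ hProj_mem F y _⟩
  have hBs {X : Π x : M, TangentSpace 𝓘(ℝ, E) x} (hX : IsSmoothFieldOn X U) :
      IsSmoothFieldOn (compB (E' := E') F (J α) X) U :=
    (hJX hX).vProj h.contMDiff h.submersion hU
  have hZ : IsSectionOn (horizontal (E := E) (E' := E') F) (fun y ↦ J α y (V y)) U :=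
    ⟨hJX hV.1, fun y hy ↦ hJ.map_le α y hy ⟨_, hV.2 y hy, rfl⟩⟩
  have hZx := hZ.2 x hx
  have hVx : V x ∈ vertical (E := E) (E' := E') F x := (hV.2 x hx).1
  -- g(CX, JV) = g(JX, JV) = g(X, V) = 0. This removes the terms with dλ(X) and dλ(Y) from the
  -- defect.
  have hC0 {X : Π x : M, TangentSpace 𝓘(ℝ, E) x}
      (hX : IsSectionOn (horizontal (E := E) (E' := E') F) X U) :
      ⟪compC (E' := E') F (J α) X x, J α x (V x)⟫_ℝ = 0 := by
    rw [compC, inner_hProj _ hZx, hJ.basis.isometry α x hx, real_inner_comm]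
    exact inner_eq_zero_of_vertical_of_horizontal hVx (hX.2 x hx)
  have hC (β : Fin 3) (X : Π x : M, TangentSpace 𝓘(ℝ, E) x) {w : TangentSpace 𝓘(ℝ, E) x}
      (hw : w ∈ horizontal (E := E) (E' := E') F x) :
      ⟪compC (E' := E') F (J β) X x, w⟫_ℝ = ⟪J β x (X x), w⟫_ℝ := inner_hProj _ hw
  -- BY is vertical, so only the summand ℋ∇𝒱 of 𝒜 meets the horizontal vector JV.
  have hA {X Y : Π x : M, TangentSpace 𝓘(ℝ, E) x}
      (hX : IsSectionOn (horizontal (E := E) (E' := E') F) X U) :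
      ⟪oneillA (E' := E') F X (compB (E' := E') F (J α) Y) x, J α x (V x)⟫_ℝ =
        ⟪leviCivita E M (compB (E' := E') F (J α) Y) x (X x), J α x (V x)⟫_ℝ := by
    have h1 : (fun y ↦ vProj (E' := E') F y (compB (E' := E') F (J α) Y y)) =
        compB (E' := E') F (J α) Y := funext fun y ↦ vProj_of_mem (vProj_mem F y _)
    rw [oneillA, h1, hProj_of_mem (hX.2 x hx), inner_add_left, inner_hProj _ hZx,
      inner_eq_zero_of_vertical_of_horizontal (vProj_mem F x _) hZx, add_zero]
  -- Split CX = JX - BX and move J across ∇ with the connection forms; the isometry J then turns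
  -- g(J∇_Y X, JV) into g(∇_Y X, V).
  have hn {X Y : Π x : M, TangentSpace 𝓘(ℝ, E) x}
      (hX : IsSectionOn (horizontal (E := E) (E' := E') F) X U) :
      ⟪leviCivita E M (compC (E' := E') F (J α) X) x (Y x), J α x (V x)⟫_ℝ =
        -⟪leviCivita E M (compB (E' := E') F (J α) X) x (Y x), J α x (V x)⟫_ℝ
        + ⟪leviCivita E M X x (Y x), V x⟫_ℝ
        + om (α + 2) x (Y x) * ⟪compC (E' := E') F (J (α + 1)) X x, J α x (V x)⟫_ℝ
        - om (α + 1) x (Y x) * ⟪compC (E' := E') F (J (α + 2)) X x, J α x (V x)⟫_ℝ := by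
    have h1 := hom.nabla_eq α X hX.1 x hx (Y x)
    have h2 : (fun y ↦ J α y (X y)) =
        compB (E' := E') F (J α) X + compC (E' := E') F (J α) X :=
      funext fun y ↦ (vProj_add_hProj F y _).symm
    have h3 := (leviCivita E M).isCovariantDerivativeOnUniv.add ((hBs hX.1).mdiffAt hU hx)
      ((hCs hX.1).1.mdiffAt hU hx) (Set.mem_univ x)
    have h4 := congrArg (fun A ↦ A (Y x)) h3
    rw [h2] at h1
    have h5 : leviCivita E M (compC (E' := E') F (J α) X) x (Y x) =
        -leviCivita E M (compB (E' := E') F (J α) X) x (Y x) + J α x (leviCivita E M X x (Y x)) +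
        (om (α + 2) x (Y x) • J (α + 1) x (X x) - om (α + 1) x (Y x) • J (α + 2) x (X x)) := by
      rw [← h1]
      refine Eq.trans ?_ (congrArg (fun u ↦ -leviCivita E M (compB (E' := E') F (J α) X) x (Y x) +
        J α x (leviCivita E M X x (Y x)) + (u - J α x (leviCivita E M X x (Y x)))) h4.symm)
      simp only [add_apply]
      abel
    rw [h5, hC _ _ hZx, hC _ _ hZx, inner_add_left, inner_add_left, inner_neg_left, inner_sub_left,
      real_inner_smul_left, real_inner_smul_left, hJ.basis.isometry α x hx]
    ring
  -- The only use of integrability: [Y, X] is horizontal while V is vertical.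
  have ht : ⟪leviCivita E M X x (Y x), V x⟫_ℝ - ⟪leviCivita E M Y x (X x), V x⟫_ℝ = 0 := by
    rw [← inner_sub_left, leviCivita_torsion (hY.1.mdiffAt hU hx) (hX.1.mdiffAt hU hx),
      real_inner_comm]
    exact inner_eq_zero_of_vertical_of_horizontal hVx (hint Y X hY hX x hx)
  have e1 := h.inner_pullbackNabla hU hY (hCs hX.1) hZ hx
  have e2 := h.inner_pullbackNabla hU hX (hCs hY.1) hZ hx
  have e3 : ⟪Y x, compC (E' := E') F (J α) X x⟫_ℝ = ⟪Y x, J α x (X x)⟫_ℝ := by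
    rw [real_inner_comm, hC _ _ (hY.2 x hx), real_inner_comm]
  -- J is skew, so this has the sign opposite to `e3`; the two dλ(JV) terms add up instead of
  -- cancelling, whence the factor 2.
  have e4 : ⟪X x, compC (E' := E') F (J α) Y x⟫_ℝ = -⟪Y x, J α x (X x)⟫_ℝ := by
    rw [real_inner_comm, hC _ _ (hX.2 x hx), hJ.basis.inner_left α hx]
  beta_reduce at e1 e2
  rw [hC0 hX, hn hX, e3] at e1
  rw [hC0 hY, hn hY, e4] at e2
  rw [inner_sub_left, inner_sub_left, e1, e2, hA hX, hA hY]
  have hl := (h.lam_pos x).ne'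
  field_simp
  linear_combination lam x * ht

theorem isHHomotheticOn_iff :
    IsHHomotheticOn (E := E) (E' := E') F lam U ↔
      ∀ x ∈ U, ∀ v ∈ horizontal (E := E) (E' := E') F x, d% lam x v = 0 := by
  have hg (x : M) (v : TangentSpace 𝓘(ℝ, E) x) : ⟪riemannianGradient lam x, v⟫_ℝ = d% lam x v := by
    have : CompleteSpace (TangentSpace 𝓘(ℝ, E) x) := FiniteDimensional.complete ℝ _
    exact InnerProductSpace.toDual_symm_apply
  refine forall₂_congr fun x hx ↦ ⟨fun h v hv ↦ ?_, fun h ↦ ?_⟩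
  · rw [← hg, ← inner_hProj (E' := E') (F := F) _ hv, h, inner_zero_left]
  · rw [← inner_self_eq_zero (𝕜 := ℝ), inner_hProj _ (hProj_mem F x _), hg]
    exact h _ (hProj_mem F x _)

theorem IsHConformalSubmersion.homotheticIdentityOn
    (h : IsHConformalSubmersion (E := E) (E' := E') F lam) (hU : IsOpen U)
    (hJ : IsAlmostSemiInvariantBasis (E' := E') Q F J D₁ U)
    (hom : IsQuaternionicConnectionForms J om U)
    (hint : IsIntegrableOn (horizontal (E := E) (E' := E') F) U)
    (hh : IsHHomotheticOn (E := E) (E' := E') F lam U) (α : Fin 3) :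
    HomotheticIdentityOn (E' := E') F lam J D₁ om U α := by
  intro X Y V hX hY hV x hx
  rw [isHHomotheticOn_iff] at hh
  rw [h.homotheticIdentity_defect hU hJ hom hint α hX hY hV hx,
    hh x hx (compC (E' := E') F (J α) X x) (hProj_mem F x _),
    hh x hx (compC (E' := E') F (J α) Y x) (hProj_mem F x _),
    hh x hx (J α x (V x)) (hJ.map_le α x hx ⟨_, hV.2 x hx, rfl⟩)]
  ring

/-- J is skew, so Jv is horizontal once v is orthogonal to J(ker F_*). That image is J𝒟₁ = 𝒟₁, which
is vertical, plus J𝒟₂, orthogonal to μ by definition. Moreover Jv is orthogonal to J𝒟₂ because v is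
orthogonal to 𝒟₂. -/
theorem IsAlmostSemiInvariantBasis.map_distMu
    (hJ : IsAlmostSemiInvariantBasis (E' := E') Q F J D₁ U) (α : Fin 3) {x : M} (hx : x ∈ U)
    {v : TangentSpace 𝓘(ℝ, E) x} (hv : v ∈ distMu (E' := E') F (J α) (D₁ α) x) :
    J α x v ∈ distMu (E' := E') F (J α) (D₁ α) x := by
  have hskew := hJ.basis.inner_left α hx
  refine ⟨fun w hw ↦ ?_, ?_⟩
  · have h1 : ⟪J α x w, v⟫_ℝ = 0 := by
      have hP : (D₁ α x).starProjection w ∈ D₁ α x := Submodule.starProjection_apply_mem _ _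
      have h2 : w - (D₁ α x).starProjection w ∈ distTwo (E' := E') F (D₁ α) x :=
        ⟨sub_mem hw (hJ.le_vertical α x hx hP), Submodule.sub_starProjection_mem_orthogonal w⟩
      have h3 : J α x ((D₁ α x).starProjection w) ∈ D₁ α x := by
        exact (hJ.map_eq α x hx).le ⟨_, hP, rfl⟩
      have h4 : ⟪J α x ((D₁ α x).starProjection w), v⟫_ℝ = 0 :=
        inner_eq_zero_of_vertical_of_horizontal (hJ.le_vertical α x hx h3) hv.1
      have h5 : ⟪J α x (w - (D₁ α x).starProjection w), v⟫_ℝ = 0 := hv.2 _ ⟨_, h2, rfl⟩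
      rw [map_sub, inner_sub_left] at h5
      linarith
    rw [hskew] at h1
    linarith
  · rintro _ ⟨w, hw, rfl⟩
    change ⟪J α x w, J α x v⟫_ℝ = 0
    rw [hJ.basis.isometry α x hx]
    exact inner_eq_zero_of_vertical_of_horizontal hw.1 hv.1

/-- The vanishing defect is tested on vectors that isolate dλ first on J𝒟₂ and then on μ. The first
test needs μ ≠ 0, the second 𝒟₂ ≠ 0. -/
theorem IsHConformalSubmersion.isHHomotheticOn [T2Space M]
    (h : IsHConformalSubmersion (E := E) (E' := E') F lam) (hU : IsOpen U)
    (hJ : IsAlmostSemiInvariantBasis (E' := E') Q F J D₁ U)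
    (hom : IsQuaternionicConnectionForms J om U)
    (hint : IsIntegrableOn (horizontal (E := E) (E' := E') F) U) {α : Fin 3}
    (hne : ∀ x ∈ U, distTwo (E' := E') F (D₁ α) x ≠ ⊥ ∧
      distMu (E' := E') F (J α) (D₁ α) x ≠ ⊥)
    (hid : HomotheticIdentityOn (E' := E') F lam J D₁ om U α) :
    IsHHomotheticOn (E := E) (E' := E') F lam U := by
  rw [isHHomotheticOn_iff]
  intro x hx
  have key (u w v : TangentSpace 𝓘(ℝ, E) x) (hu : u ∈ horizontal (E := E) (E' := E') F x)
      (hw : w ∈ horizontal (E := E) (E' := E') F x) (hv : v ∈ distTwo (E' := E') F (D₁ α) x) :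
      d% lam x (hProj (E' := E') F x (J α x u)) * ⟪w, J α x v⟫_ℝ
        - d% lam x (hProj (E' := E') F x (J α x w)) * ⟪u, J α x v⟫_ℝ
        - 2 * (d% lam x (J α x v) * ⟪w, J α x u⟫_ℝ) = 0 := by
    obtain ⟨X, hX, rfl⟩ := exists_isSectionOn_horizontal h.contMDiff h.submersion hU hu
    obtain ⟨Y, hY, rfl⟩ := exists_isSectionOn_horizontal h.contMDiff h.submersion hU hw
    obtain ⟨V, hV, rfl⟩ := exists_isSectionOn_distTwo h.contMDiff h.submersion hU
      (hJ.distribution α) (hJ.le_vertical α) hv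
    have h1 := hid X Y V hX hY hV x hx
    rw [h.homotheticIdentity_defect hU hJ hom hint α hX hY hV hx, add_eq_left] at h1
    exact (mul_eq_zero.1 h1).resolve_left (inv_ne_zero (h.lam_pos x).ne')
  obtain ⟨⟨v₀, hv₀, hv₀0⟩, m₀, hm₀, hm₀0⟩ :=
    And.imp (Submodule.ne_bot_iff _).1 (Submodule.ne_bot_iff _).1 (hne x hx)
  have hmu {m v : TangentSpace 𝓘(ℝ, E) x} (hm : m ∈ distMu (E' := E') F (J α) (D₁ α) x)
      (hv : v ∈ distTwo (E' := E') F (D₁ α) x) : ⟪m, J α x v⟫_ℝ = 0 := by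
    rw [real_inner_comm]
    exact hm.2 _ ⟨v, hv, rfl⟩
  have hD {v : TangentSpace 𝓘(ℝ, E) x} (hv : v ∈ distTwo (E' := E') F (D₁ α) x) :
      d% lam x (J α x v) = 0 := by
    have hJm := hJ.map_distMu α hx hm₀
    -- Both `m₀` and `J m₀` are orthogonal to J𝒟₂, so only -2 dλ(Jv)|m₀|² survives.
    have h1 := key m₀ (J α x m₀) v hm₀.1 hJm.1 hv
    rw [hmu hm₀ hv, hmu hJm hv, hJ.basis.isometry α x hx] at h1
    simpa [hm₀0] using h1
  have hM {m : TangentSpace 𝓘(ℝ, E) x} (hm : m ∈ distMu (E' := E') F (J α) (D₁ α) x) :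
      d% lam x m = 0 := by
    have hJm := hJ.map_distMu α hx hm
    -- Here C(Jm) = J(Jm) = -m, and the other two terms vanish by orthogonality and by `hD`; what
    -- remains is -dλ(m)|v₀|² = 0.
    have h1 := key (J α x m) (J α x v₀) v₀ hJm.1 (hJ.map_le α x hx ⟨v₀, hv₀, rfl⟩) hv₀
    rw [hmu hJm hv₀, hD hv₀, hJ.basis.isometry α x hx, hJ.basis.sq α x hx,
      hProj_of_mem (neg_mem hm.1)] at h1
    simpa [hv₀0] using h1
  intro v hv
  set K := (distTwo (E' := E') F (D₁ α) x).map (J α x).toLinearMap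
  have hP : K.starProjection v ∈ K := Submodule.starProjection_apply_mem _ _
  -- Split a horizontal vector into its J𝒟₂ component and the remainder, which lies in μ.
  have h1 : d% lam x (v - K.starProjection v) = 0 :=
    hM ⟨sub_mem hv (hJ.map_le α x hx hP), Submodule.sub_starProjection_mem_orthogonal v⟩
  obtain ⟨w, hw, hw'⟩ := hP
  have h2 : d% lam x (K.starProjection v) = 0 := by
    rw [← hw']
    exact hD hw
  rw [map_sub, h2, sub_zero] at h1
  exact h1

end Conformal

end

theorem mainTheorem2
    {E : Type*} [NormedAddCommGroup E] [NormedSpace ℝ E] [FiniteDimensional ℝ E]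
    {M : Type*} [TopologicalSpace M] [T2Space M] [SecondCountableTopology M]
    [ChartedSpace E M] [IsManifold 𝓘(ℝ, E) ∞ M]
    [RiemannianBundle (fun x : M ↦ TangentSpace 𝓘(ℝ, E) x)]
    [IsContMDiffRiemannianBundle 𝓘(ℝ, E) ∞ E (fun x : M ↦ TangentSpace 𝓘(ℝ, E) x)]
    {E' : Type*} [NormedAddCommGroup E'] [NormedSpace ℝ E'] [FiniteDimensional ℝ E']
    {N : Type*} [TopologicalSpace N] [T2Space N] [SecondCountableTopology N]
    [ChartedSpace E' N] [IsManifold 𝓘(ℝ, E') ∞ N]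
    [RiemannianBundle (fun y : N ↦ TangentSpace 𝓘(ℝ, E') y)]
    [IsContMDiffRiemannianBundle 𝓘(ℝ, E') ∞ E' (fun y : N ↦ TangentSpace 𝓘(ℝ, E') y)]
    (Q : Π x : M, Submodule ℝ (TangentSpace 𝓘(ℝ, E) x →L[ℝ] TangentSpace 𝓘(ℝ, E) x))
    (hQ : IsQuaternionicKahler Q)
    (F : M → N) (lam : M → ℝ)
    (hF : IsAlmostHConformalSemiInvariant (E' := E') Q F lam)
    (U : Set M) (hU : IsOpen U)
    (J : Fin 3 → Π x : M, TangentSpace 𝓘(ℝ, E) x →L[ℝ] TangentSpace 𝓘(ℝ, E) x)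
    (D₁ : Fin 3 → Π x : M, Submodule ℝ (TangentSpace 𝓘(ℝ, E) x))
    (hJ : IsAlmostSemiInvariantBasis (E' := E') Q F J D₁ U)
    (om : Fin 3 → Π x : M, TangentSpace 𝓘(ℝ, E) x →L[ℝ] ℝ)
    (hom : IsQuaternionicConnectionForms J om U)
    (hint : IsIntegrableOn (horizontal (E := E) (E' := E') F) U) :
    (IsHHomotheticOn (E := E) (E' := E') F lam U →
      ∀ α, HomotheticIdentityOn (E' := E') F lam J D₁ om U α) ∧
    (∀ α, (∀ x ∈ U, distTwo (E' := E') F (D₁ α) x ≠ ⊥ ∧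
        distMu (E' := E') F (J α) (D₁ α) x ≠ ⊥) →
      (IsHHomotheticOn (E := E) (E' := E') F lam U ↔
        HomotheticIdentityOn (E' := E') F lam J D₁ om U α)) ∧
    ((∀ α, ∀ x ∈ U, distTwo (E' := E') F (D₁ α) x ≠ ⊥ ∧
        distMu (E' := E') F (J α) (D₁ α) x ≠ ⊥) →
      [IsHHomotheticOn (E := E) (E' := E') F lam U,
        HomotheticIdentityOn (E' := E') F lam J D₁ om U 0,
        HomotheticIdentityOn (E' := E') F lam J D₁ om U 1,
        HomotheticIdentityOn (E' := E') F lam J D₁ om U 2].TFAE) := by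
  have hc := hF.hConformal
  have h2 (α) (hne : ∀ x ∈ U, distTwo (E' := E') F (D₁ α) x ≠ ⊥ ∧
      distMu (E' := E') F (J α) (D₁ α) x ≠ ⊥) : IsHHomotheticOn (E := E) (E' := E') F lam U ↔
        HomotheticIdentityOn (E' := E') F lam J D₁ om U α :=
    ⟨fun hh ↦ hc.homotheticIdentityOn hU hJ hom hint hh α, hc.isHHomotheticOn hU hJ hom hint hne⟩
  refine ⟨fun hh α ↦ hc.homotheticIdentityOn hU hJ hom hint hh α, h2, fun hne ↦ ?_⟩
  tfae_have 1 ↔ 2 := h2 0 (hne 0)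
  tfae_have 1 ↔ 3 := h2 1 (hne 1)
  tfae_have 1 ↔ 4 := h2 2 (hne 2)
  tfae_finish
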